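/- For every $\lambda>0$ there is a constant $C$, depending only on $\lambda$, with the following property. Let $K\subset\mathbb{R}^3$ be a convex body (a compact convex set with non-empty interior) containing the origin $o$. Let $h_K(u)=\max\{u\cdot y: y\in K\}$, $u\in\mathbb{S}^2$, be its support function. Let $S_K$ be its surface area measure, i.e. the Borel measure on $\mathbb{S}^2$ given by $S_K(\omega)=\mathcal{H}^2(\nu_K^{-1}(\omega))$, where $\nu_K^{-1}(\omega)$ is the set of the boundary points $x$ of $K$ that have an outer unit normal in $\omega$ (a $u\in\omega$ with $u\cdot z\le u\cdot x$ for all $z\in K$), and $\mathcal{H}^2$ is two-dimensional Hausdorff measure. Let $f:\mathbb{S}^2\to\mathbb{R}$ be measurable with $1/\lambda<f(u)<\lambda$ for all $u\in\mathbb{S}^2$. If $$h_K\,dS_K=f\,d\mathcal{H}^2$$ as measures on $\mathbb{S}^2$ (equivalently, if three times the cone-volume measure of $K$ has density $f$ with respect to $\mathcal{H}^2$), then $$\|h_K\|_{L^\infty(\mathbb{S}^2)}=\max_{u\in\mathbb{S}^2}|h_K(u)|\le C.$$ -/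

import Mathlib

open MeasureTheory Set Metric
open scoped NNReal ENNReal RealInnerProductSpace

namespace LogMinkowski

/-- Euclidean three-space. -/
abbrev E3 : Type := EuclideanSpace ℝ (Fin 3)

/-- The unit sphere of Euclidean three-space. -/
abbrev S2 : Type := sphere (0 : E3) 1

/-- The support function `h_K : S² → ℝ`, `h_K u = max {u · y : y ∈ K}`
(the supremum is attained, since `K` is compact and non-empty). -/
noncomputable def supportFunction (K : ConvexBody E3) (u : S2) : ℝ :=
  sSup ((fun y : E3 => ⟪(u : E3), y⟫) '' (K : Set E3))

/-- The set-valued normal map: the unit vectors `ν` with `ν · z ≤ ν · x` for all `z ∈ K`. -/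
def normalMap (K : ConvexBody E3) (x : E3) : Set S2 :=
  {u | ∀ z ∈ K, ⟪(u : E3), z⟫ ≤ ⟪(u : E3), x⟫}

/-- The inverse image of `ω ⊆ S²` under the set-valued normal map `∂K → S²`: the boundary points
of `K` that have some outer unit normal in `ω`. -/
def normalPreimage (K : ConvexBody E3) (ω : Set S2) : Set E3 :=
  {x | x ∈ frontier (K : Set E3) ∧ (normalMap K x ∩ ω).Nonempty}

theorem normalPreimage_iUnion (K : ConvexBody E3) (s : ℕ → Set S2) :
    normalPreimage K (⋃ i, s i) = ⋃ i, normalPreimage K (s i) := by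
  ext x
  simp only [normalPreimage, Set.mem_ofPred_eq, Set.inter_iUnion, Set.nonempty_iUnion,
    Set.mem_iUnion]
  tauto

theorem normalPreimage_mono (K : ConvexBody E3) {s t : Set S2} (h : s ⊆ t) :
    normalPreimage K s ⊆ normalPreimage K t :=
  fun _ hx => ⟨hx.1, hx.2.mono (Set.inter_subset_inter_right _ h)⟩

/-- The set function `ω ↦ H²(ν_K⁻¹(ω))`, as an outer measure. -/
noncomputable def surfaceAreaOuter (K : ConvexBody E3) : OuterMeasure S2 where
  measureOf ω := Measure.euclideanHausdorffMeasure 2 (normalPreimage K ω)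
  empty := by simp [normalPreimage]
  mono h := measure_mono (normalPreimage_mono K h)
  iUnion_nat s _ := by
    rw [normalPreimage_iUnion]
    exact measure_iUnion_le _

/-- The boundary points with at least two outer unit normals. -/
def singularSet (K : ConvexBody E3) : Set E3 :=
  {x | x ∈ frontier (K : Set E3) ∧ ∃ u ∈ normalMap K x, ∃ v ∈ normalMap K x, u ≠ v}

/-- The line through `(r, s)` in the coordinates other than `i`, in the direction `i`. -/
noncomputable def coordLine (i : Fin 3) (r s t : ℝ) : E3 :=
  WithLp.toLp 2 (fun j => if j = i then t else if j = i + 1 then r else s)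

/-- The points of `K` nearest to some point of a given coordinate line. -/
def feet (K : ConvexBody E3) (i : Fin 3) (r s : ℝ) : Set E3 :=
  {x | x ∈ K ∧ ∃ t : ℝ, ∀ z ∈ K, ⟪coordLine i r s t - x, z - x⟫ ≤ 0}

theorem coordLine_dist (i : Fin 3) (r s t t' : ℝ) :
    dist (coordLine i r s t) (coordLine i r s t') = dist t t' := by
  rw [EuclideanSpace.dist_eq, Real.dist_eq]
  fin_cases i <;> simp [coordLine, Fin.sum_univ_three, Real.dist_eq, Real.sqrt_sq_eq_abs]

theorem foot_contract (K : ConvexBody E3) {p q x y : E3} (hx : x ∈ K) (hy : y ∈ K)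
    (hp : ∀ z ∈ K, ⟪p - x, z - x⟫ ≤ 0) (hq : ∀ z ∈ K, ⟪q - y, z - y⟫ ≤ 0) :
    dist x y ≤ dist p q := by
  rw [dist_eq_norm, dist_eq_norm]
  have h1 := hp y hy
  have h2 := hq x hx
  have h3 : ‖x - y‖ * ‖x - y‖ ≤ ⟪p - q, x - y⟫ := by
    rw [← real_inner_self_eq_norm_mul_norm]
    simp only [inner_sub_left, inner_sub_right] at *
    linarith
  have h4 := real_inner_le_norm (p - q) (x - y)
  by_contra! h
  have : 0 < ‖x - y‖ := lt_of_le_of_lt (norm_nonneg _) h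
  nlinarith

theorem feet_null (K : ConvexBody E3) (i : Fin 3) (r s : ℝ) :
    Measure.euclideanHausdorffMeasure 2 (feet K i r s) = 0 := by
  classical
  let T : Set ℝ := {t | ∃ x ∈ K, ∀ z ∈ K, ⟪coordLine i r s t - x, z - x⟫ ≤ 0}
  let p : ℝ → E3 := fun t => if h : t ∈ T then h.choose else 0
  have hp : ∀ t ∈ T, p t ∈ K ∧ ∀ z ∈ K, ⟪coordLine i r s t - p t, z - p t⟫ ≤ 0 := by
    intro t ht
    have : p t = ht.choose := dif_pos ht
    rw [this]
    exact ht.choose_spec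
  have hlip : LipschitzOnWith 1 p T := by
    refine LipschitzOnWith.of_dist_le_mul fun t ht t' ht' => ?_
    rw [NNReal.coe_one, one_mul, ← coordLine_dist i r s t t']
    exact foot_contract K (hp t ht).1 (hp t' ht').1 (hp t ht).2 (hp t' ht').2
  have hsub : feet K i r s ⊆ p '' T := by
    rintro x ⟨hx, t, ht⟩
    have htT : t ∈ T := ⟨x, hx, ht⟩
    refine ⟨t, htT, ?_⟩
    have := foot_contract K (hp t htT).1 hx (hp t htT).2 ht
    rw [dist_self] at this
    exact dist_le_zero.1 this
  have hT : Measure.hausdorffMeasure (2 : ℝ) T = 0 := by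
    refine measure_mono_null (Set.subset_univ T) ?_
    have := hausdorffMeasure_of_dimH_lt (s := (Set.univ : Set ℝ)) (d := 2)
      (by rw [Real.dimH_univ]; norm_num)
    simpa using this
  have h0 : Measure.hausdorffMeasure (2 : ℝ) (p '' T) = 0 := by
    have := hlip.hausdorffMeasure_image_le (d := 2) (by norm_num)
    rw [hT, mul_zero] at this
    exact le_antisymm this bot_le
  refine measure_mono_null hsub ?_
  rw [Measure.euclideanHausdorffMeasure_def, Measure.smul_apply]
  simp [h0]

theorem exists_rat_sector (x₁ x₂ u₁ u₂ v₁ v₂ : ℝ) (h : u₁ * v₂ - u₂ * v₁ ≠ 0) :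
    ∃ r s : ℚ, ∃ a b : ℝ, 0 < a ∧ 0 < b ∧
      x₁ + a * u₁ + b * v₁ = r ∧ x₂ + a * u₂ + b * v₂ = s := by
  let A : ℝ × ℝ → ℝ := fun q => ((q.1 - x₁) * v₂ - (q.2 - x₂) * v₁) / (u₁ * v₂ - u₂ * v₁)
  let B : ℝ × ℝ → ℝ := fun q => (u₁ * (q.2 - x₂) - u₂ * (q.1 - x₁)) / (u₁ * v₂ - u₂ * v₁)
  have hA : Continuous A := by fun_prop
  have hB : Continuous B := by fun_prop
  have ho : IsOpen {q : ℝ × ℝ | 0 < A q ∧ 0 < B q} :=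
    (isOpen_lt continuous_const hA).inter (isOpen_lt continuous_const hB)
  have hne : {q : ℝ × ℝ | 0 < A q ∧ 0 < B q}.Nonempty := by
    refine ⟨(x₁ + u₁ + v₁, x₂ + u₂ + v₂), ?_, ?_⟩
    · have : A (x₁ + u₁ + v₁, x₂ + u₂ + v₂) = 1 := by
        simp only [A]; rw [div_eq_one_iff_eq h]; ring
      rw [this]; exact one_pos
    · have : B (x₁ + u₁ + v₁, x₂ + u₂ + v₂) = 1 := by
        simp only [B]; rw [div_eq_one_iff_eq h]; ring
      rw [this]; exact one_pos
  have hd : DenseRange (Prod.map ((↑) : ℚ → ℝ) ((↑) : ℚ → ℝ)) :=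
    Rat.denseRange_cast.prodMap Rat.denseRange_cast
  obtain ⟨⟨r, s⟩, h1, h2⟩ := hd.exists_mem_open ho hne
  refine ⟨r, s, A (r, s), B (r, s), h1, h2, ?_, ?_⟩
  · have e : A (r, s) * u₁ + B (r, s) * v₁ = r - x₁ := by
      simp only [A, B]
      rw [div_mul_eq_mul_div, div_mul_eq_mul_div, ← add_div, div_eq_iff h]
      ring
    linarith
  · have e : A (r, s) * u₂ + B (r, s) * v₂ = s - x₂ := by
      simp only [A, B]
      rw [div_mul_eq_mul_div, div_mul_eq_mul_div, ← add_div, div_eq_iff h]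
      ring
    linarith

theorem normal_ne_neg (K : ConvexBody E3) (hK : (interior (K : Set E3)).Nonempty) {x : E3}
    {u v : S2} (hu : u ∈ normalMap K x) (hv : v ∈ normalMap K x) : (u : E3) ≠ -(v : E3) := by
  intro h
  obtain ⟨y, hy⟩ := hK
  have hn : ‖(u : E3)‖ = 1 := by simp
  obtain ⟨ε, hε, hball⟩ := Metric.mem_nhds_iff.1 (mem_interior_iff_mem_nhds.1 hy)
  have hy1 : y + (ε / 2) • (u : E3) ∈ (K : Set E3) := by
    apply hball
    simp only [mem_ball, dist_self_add_left, norm_smul, hn, mul_one, Real.norm_eq_abs]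
    rw [abs_of_pos (by positivity)]
    linarith
  have h1 := hu _ hy1
  have h2 := hv _ (interior_subset hy)
  have hvu : (v : E3) = -(u : E3) := by rw [h, neg_neg]
  rw [hvu, inner_neg_left, inner_neg_left] at h2
  rw [inner_add_right, inner_smul_right, real_inner_self_eq_norm_sq, hn] at h1
  nlinarith

theorem exists_minor {u v : E3} (hu : ‖u‖ = 1) (hv : ‖v‖ = 1) (h1 : u ≠ v) (h2 : u ≠ -v) :
    ∃ i : Fin 3, u (i + 1) * v (i + 2) - u (i + 2) * v (i + 1) ≠ 0 := by
  by_contra! h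
  have e0 := h 0
  have e1 := h 1
  have e2 := h 2
  simp only [Fin.isValue, zero_add, show (1 : Fin 3) + 1 = 2 from rfl,
    show (1 : Fin 3) + 2 = 0 from rfl, show (2 : Fin 3) + 1 = 0 from rfl,
    show (2 : Fin 3) + 2 = 1 from rfl] at e0 e1 e2
  have hu' : u 0 ^ 2 + u 1 ^ 2 + u 2 ^ 2 = 1 := by
    have := EuclideanSpace.real_norm_sq_eq u
    rw [hu, Fin.sum_univ_three] at this
    linarith
  have hv' : v 0 ^ 2 + v 1 ^ 2 + v 2 ^ 2 = 1 := by
    have := EuclideanSpace.real_norm_sq_eq v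
    rw [hv, Fin.sum_univ_three] at this
    linarith
  have hin : ⟪u, v⟫ = u 0 * v 0 + u 1 * v 1 + u 2 * v 2 := by
    rw [PiLp.inner_apply, Fin.sum_univ_three]
    simp [mul_comm]
  have hsq : ⟪u, v⟫ ^ 2 = 1 := by
    rw [hin]
    have : (u 0 * v 0 + u 1 * v 1 + u 2 * v 2) ^ 2 =
        (u 0 ^ 2 + u 1 ^ 2 + u 2 ^ 2) * (v 0 ^ 2 + v 1 ^ 2 + v 2 ^ 2)
        - (u 1 * v 2 - u 2 * v 1) ^ 2 - (u 2 * v 0 - u 0 * v 2) ^ 2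
        - (u 0 * v 1 - u 1 * v 0) ^ 2 := by ring
    rw [this, hu', hv', e0, e1, e2]
    ring
  rcases (eq_or_eq_neg_of_sq_eq_sq ⟪u, v⟫ 1 (by rw [hsq, one_pow])) with h | h
  · exact h1 ((inner_eq_one_iff_of_norm_eq_one hu hv).1 h)
  · apply h2
    have : ⟪u, -v⟫ = 1 := by rw [inner_neg_right, h, neg_neg]
    exact (inner_eq_one_iff_of_norm_eq_one hu (by rwa [norm_neg])).1 this

theorem singularSet_subset (K : ConvexBody E3) (hK : (interior (K : Set E3)).Nonempty) :
    singularSet K ⊆ ⋃ i : Fin 3, ⋃ r : ℚ, ⋃ s : ℚ, feet K i r s := by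
  rintro x ⟨hxf, u, hu, v, hv, huv⟩
  obtain ⟨i, hi⟩ := exists_minor (u := u) (v := v) (by simp) (by simp)
    (fun h => huv (Subtype.ext h)) (normal_ne_neg K hK hu hv)
  obtain ⟨r, s, a, b, ha, hb, hr, hs⟩ := exists_rat_sector (x (i + 1)) (x (i + 2)) _ _ _ _ hi
  simp only [Set.mem_iUnion]
  refine ⟨i, r, s, K.isClosed.frontier_subset hxf,
    (x + a • (u : E3) + b • (v : E3)) i, fun z hz => ?_⟩
  have hline : coordLine i r s ((x + a • (u : E3) + b • (v : E3)) i) =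
      x + a • (u : E3) + b • (v : E3) := by
    ext j
    simp only [coordLine]
    split_ifs with h1 h2
    · rw [h1]
    · rw [h2, ← hr]; simp
    · have : j = i + 2 := by
        revert h1 h2
        fin_cases i <;> fin_cases j <;> simp
      rw [this, ← hs]; simp
  have h1 := hu z hz
  have h2 := hv z hz
  rw [hline]
  have : x + a • (u : E3) + b • (v : E3) - x = a • (u : E3) + b • (v : E3) := by abel
  rw [this, inner_add_left, real_inner_smul_left, real_inner_smul_left, inner_sub_right,
    inner_sub_right]
  nlinarith

theorem singularSet_null (K : ConvexBody E3) (hK : (interior (K : Set E3)).Nonempty) :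
    Measure.euclideanHausdorffMeasure 2 (singularSet K) = 0 := by
  refine measure_mono_null (singularSet_subset K hK) ?_
  simp only [measure_iUnion_null_iff]
  exact fun i r s => feet_null K i r s

theorem normalPreimage_isClosed (K : ConvexBody E3) {ω : Set S2} (hω : IsClosed ω) :
    IsClosed (normalPreimage K ω) := by
  have hC : IsClosed {q : E3 × S2 | q.1 ∈ frontier (K : Set E3) ∧ q.2 ∈ normalMap K q.1 ∧
      q.2 ∈ ω} := by
    refine (isClosed_frontier.preimage continuous_fst).inter
      (IsClosed.inter ?_ (hω.preimage continuous_snd))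
    have e : {q : E3 × S2 | q.2 ∈ normalMap K q.1} =
        ⋂ z ∈ K, {q : E3 × S2 | ⟪(q.2 : E3), z⟫ ≤ ⟪(q.2 : E3), q.1⟫} := by
      ext q
      simp [normalMap]
    change IsClosed {q : E3 × S2 | q.2 ∈ normalMap K q.1}
    rw [e]
    exact isClosed_iInter fun z => isClosed_iInter fun _ =>
      isClosed_le (by fun_prop) (by fun_prop)
  have := isClosedMap_fst_of_compactSpace (X := E3) (Y := S2) _ hC
  convert this using 1
  ext x
  simp only [normalPreimage, Set.mem_ofPred_eq, Set.mem_image, Prod.exists, Set.Nonempty,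
    Set.mem_inter_iff]
  constructor
  · rintro ⟨h1, u, h2, h3⟩
    exact ⟨x, u, ⟨h1, h2, h3⟩, rfl⟩
  · rintro ⟨_, u, ⟨h1, h2, h3⟩, rfl⟩
    exact ⟨h1, u, h2, h3⟩

theorem surfaceAreaOuter_caratheodory (K : ConvexBody E3)
    (hK : (interior (K : Set E3)).Nonempty) :
    (inferInstance : MeasurableSpace S2) ≤ (surfaceAreaOuter K).caratheodory := by
  rw [BorelSpace.measurable_eq (α := S2), borel_eq_generateFrom_isClosed]
  refine MeasurableSpace.generateFrom_le fun ω hω => ?_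
  rw [OuterMeasure.isCaratheodory_iff_le]
  intro A
  change Measure.euclideanHausdorffMeasure 2 (normalPreimage K (A ∩ ω)) +
    Measure.euclideanHausdorffMeasure 2 (normalPreimage K (A \ ω)) ≤
    Measure.euclideanHausdorffMeasure 2 (normalPreimage K A)
  have hm : MeasurableSet (normalPreimage K ω) := (normalPreimage_isClosed K hω).measurableSet
  rw [← measure_inter_add_sdiff (normalPreimage K A) hm]
  refine add_le_add (measure_mono ?_) ?_
  · exact Set.subset_inter (normalPreimage_mono K Set.inter_subset_left)
      (normalPreimage_mono K Set.inter_subset_right)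
  · have hsub : normalPreimage K (A \ ω) ⊆
        (normalPreimage K A \ normalPreimage K ω) ∪ singularSet K := by
      rintro x ⟨hx, u, hu, huA, huω⟩
      by_cases h : x ∈ normalPreimage K ω
      · obtain ⟨-, v, hv, hvω⟩ := h
        exact Or.inr ⟨hx, u, hu, v, hv, fun e => huω (e ▸ hvω)⟩
      · exact Or.inl ⟨⟨hx, u, hu, huA⟩, h⟩
    refine (measure_mono hsub).trans ((measure_union_le _ _).trans ?_)
    rw [singularSet_null K hK, add_zero]

/-- The surface area measure `S_K` of a convex body `K` with non-empty interior: the Borel measure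
on `S²` with `S_K(ω) = H²(ν_K⁻¹(ω))` (see `surfaceAreaMeasure_apply`). -/
noncomputable def surfaceAreaMeasure (K : ConvexBody E3)
    (hK : (interior (K : Set E3)).Nonempty) : Measure S2 :=
  (surfaceAreaOuter K).toMeasure (surfaceAreaOuter_caratheodory K hK)

theorem surfaceAreaMeasure_apply (K : ConvexBody E3) (hK : (interior (K : Set E3)).Nonempty)
    {ω : Set S2} (hω : MeasurableSet ω) :
    surfaceAreaMeasure K hK ω = Measure.euclideanHausdorffMeasure 2 (normalPreimage K ω) :=
  toMeasure_apply _ _ hω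

/-- The measure `h_K dS_K`, i.e. three times the cone-volume measure of `K`; it is used for `K`
containing the origin, where `h_K ≥ 0`. -/
noncomputable def supportSurfaceMeasure (K : ConvexBody E3)
    (hK : (interior (K : Set E3)).Nonempty) : Measure S2 :=
  (surfaceAreaMeasure K hK).withDensity fun u => ENNReal.ofReal (supportFunction K u)

/-- The two-dimensional Hausdorff measure on `S²`. -/
noncomputable def sphereArea : Measure S2 := Measure.euclideanHausdorffMeasure 2

end LogMinkowski

/-!
Write `R` for the largest distance from the origin to a point of `K`; it bounds `h_K`. The measure
`h_K dS_K` lies between `λ⁻¹` and `λ` times the area `σ` of the sphere, and `R` is bounded by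
playing three consequences of this against each other.

* `sphereArea_le_surfaceArea`: where `h_K ≤ H`, the surface area measure is at least `σ / (λ H)`.
  On the other hand, the part of `∂K` with normals within `60` degrees of `± b k` is a Lipschitz
  graph, so its area is at most `9` times that of the projection of `K` along `b k`
  (`surfaceArea_cap_le`).
* `chord_mul_area_le`: if `g • b k ∈ K`, then `h_K(u) ≥ g (u · b k)`, and `|u · b k| dS_K`
  dominates the area of the projection along `b k`, up to a constant
  (`shadowOuter_le_lintegral`). So `h_K dS_K` gives the normals over a plane region `D` a mass of
  at least a constant times `|g|` times the area of `D`. Comparisons up to constant factors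
  suffice everywhere, and these follow from the behaviour of Hausdorff measure under Lipschitz
  maps and from linear changes of variables in the plane, without an area formula for surfaces.
* `sphereArea_band_le`: a band of width `δ` about a great circle has area `O(δ)`.

Take the direction `b 2` of a farthest point `R • b 2` of `K`, let `r` be the largest distance of
a point of `K` from this axis, attained in the direction `b 1`, and let `w` be the largest
distance from the plane of `b 1` and `b 2`.

`K` is not a needle, i.e. `R ≤ M r` (`exists_length_le_width`). The chord `[0, R • b 2]` bounds
`R` times the area of the projection of `K` along the axis. If `K` reached only to a depth `L`
with `L + r` much smaller than `R` below the origin, then `h_K ≤ L + r` on the lower hemisphere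
would force the lower part of `∂K`, and with it this projection, to be too large. So the origin
lies deep inside the needle. Then all normals at the middle part of the needle are within
`O(r / R)` of the plane orthogonal to the axis; these form a narrow band, but a positive
proportion of `h_K dS_K` would live on it.

`K` is not a plate, i.e. `R` is bounded if `R ≤ M r` (`exists_length_le_of_plate`). The chord
`[0, R • b 2]` gives `R r w = O(1)`. If the support function were much smaller than `R` in a
direction `v` of the plate, then `∫ 1 / h_K` over the normals near `v` would be of order
`R⁻¹` times a large logarithm, whereas the rim of the plate has area only `O(R w) = O(R⁻¹)`
(`number_of_shells_le`). So the projection of `K` to the plane of the plate contains a disk of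
radius `d R` around the origin (`exists_shadow_eq`), and the chord through the origin orthogonal
to the plate has length at least a constant times `w` (`exists_chord`). All normals over the
middle of the disk are within `O(w / R)` of the axis of the plate, hence in a band of that width.
This gives `w R ^ 2 = O(w / R)` (`length_le_of_disk`).
-/

namespace LogMinkowski

/-! ### Plane projections and comparison of areas -/

/-- The Euclidean plane, in which orthogonal projections of subsets of `E3` are recorded. -/
abbrev E2 : Type := EuclideanSpace ℝ (Fin 2)

/-- The orthogonal projection onto the plane spanned by the `i`-th and `j`-th vectors of an
orthonormal frame, in the coordinates given by these two vectors. -/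
noncomputable def shadow (b : OrthonormalBasis (Fin 3) ℝ E3) (i j : Fin 3) (x : E3) : E2 :=
  !₂[⟪b i, x⟫, ⟪b j, x⟫]

@[simp] theorem shadow_zero_coord (b : OrthonormalBasis (Fin 3) ℝ E3) (i j : Fin 3) (x : E3) :
    shadow b i j x 0 = ⟪b i, x⟫ := by simp [shadow]

@[simp] theorem shadow_one_coord (b : OrthonormalBasis (Fin 3) ℝ E3) (i j : Fin 3) (x : E3) :
    shadow b i j x 1 = ⟪b j, x⟫ := by simp [shadow]

/-- The three indices are distinct, so that they exhaust `Fin 3`. -/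
def Distinct (i j k : Fin 3) : Prop := i ≠ j ∧ j ≠ k ∧ i ≠ k

theorem Distinct.rotate {i j k : Fin 3} (h : Distinct i j k) : Distinct j k i :=
  ⟨h.2.1, h.2.2.symm, h.1.symm⟩

theorem Distinct.swap {i j k : Fin 3} (h : Distinct i j k) : Distinct j i k :=
  ⟨h.1.symm, h.2.2, h.2.1⟩

theorem sum_distinct {i j k : Fin 3} (h : Distinct i j k) (f : Fin 3 → ℝ) :
    ∑ l, f l = f i + f j + f k := by
  obtain ⟨h1, h2, h3⟩ := h
  rw [Fin.sum_univ_three]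
  fin_cases i <;> fin_cases j <;> fin_cases k <;> simp at h1 h2 h3 ⊢ <;> ring

theorem inner_frame (b : OrthonormalBasis (Fin 3) ℝ E3) {i j k : Fin 3} (h : Distinct i j k)
    (x y : E3) :
    ⟪x, y⟫ = ⟪b i, x⟫ * ⟪b i, y⟫ + ⟪b j, x⟫ * ⟪b j, y⟫ + ⟪b k, x⟫ * ⟪b k, y⟫ := by
  rw [← b.sum_inner_mul_inner x y, sum_distinct h]
  simp only [real_inner_comm]

theorem norm_sq_frame (b : OrthonormalBasis (Fin 3) ℝ E3) {i j k : Fin 3} (h : Distinct i j k)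
    (x : E3) : ‖x‖ ^ 2 = ⟪b i, x⟫ ^ 2 + ⟪b j, x⟫ ^ 2 + ⟪b k, x⟫ ^ 2 := by
  rw [← real_inner_self_eq_norm_sq, inner_frame b h]
  ring

theorem norm_sq_E2 (x : E2) : ‖x‖ ^ 2 = x 0 ^ 2 + x 1 ^ 2 := by
  rw [EuclideanSpace.real_norm_sq_eq, Fin.sum_univ_two]

theorem continuous_shadow (b : OrthonormalBasis (Fin 3) ℝ E3) (i j : Fin 3) :
    Continuous (shadow b i j) := by
  unfold shadow
  refine (PiLp.continuous_toLp 2 _).comp (continuous_pi fun l => ?_)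
  fin_cases l <;> simp <;> fun_prop

theorem shadow_sub (b : OrthonormalBasis (Fin 3) ℝ E3) (i j : Fin 3) (x y : E3) :
    shadow b i j (x - y) = shadow b i j x - shadow b i j y := by
  ext l
  fin_cases l <;> simp [inner_sub_right]

/-- A comparison of areas: if `F` expands distances on `A` at most `C` times as much as `G` does,
then it expands areas at most `C ^ 2` times as much. -/
theorem area_image_le_of_dist_le {X Y Z : Type*} [MetricSpace Y] [MeasurableSpace Y]
    [BorelSpace Y] [MetricSpace Z] [MeasurableSpace Z] [BorelSpace Z] {F : X → Y} {G : X → Z}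
    {A : Set X} (C : ℝ≥0)
    (h : ∀ x ∈ A, ∀ y ∈ A, dist (F x) (F y) ≤ C * dist (G x) (G y)) :
    μHE[2] (F '' A) ≤ (C : ℝ≥0∞) ^ 2 * μHE[2] (G '' A) := by
  rcases A.eq_empty_or_nonempty with rfl | ⟨a, ha⟩
  · simp
  have : Nonempty X := ⟨a⟩
  let r : Z → X := Function.invFunOn G A
  have hr : ∀ x ∈ A, r (G x) ∈ A ∧ G (r (G x)) = G x := fun x hx =>
    ⟨Function.invFunOn_mem ⟨x, hx, rfl⟩, Function.invFunOn_eq ⟨x, hx, rfl⟩⟩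
  have hL : LipschitzOnWith C (F ∘ r) (G '' A) := by
    refine LipschitzOnWith.of_dist_le_mul ?_
    rintro _ ⟨x, hx, rfl⟩ _ ⟨y, hy, rfl⟩
    have := h _ (hr x hx).1 _ (hr y hy).1
    rwa [(hr x hx).2, (hr y hy).2] at this
  have hsub : F '' A ⊆ (F ∘ r) '' (G '' A) := by
    rintro _ ⟨x, hx, rfl⟩
    refine ⟨G x, ⟨x, hx, rfl⟩, ?_⟩
    have := h _ (hr x hx).1 x hx
    rw [(hr x hx).2, dist_self, mul_zero] at this
    exact dist_le_zero.1 this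
  refine (measure_mono hsub).trans ?_
  have := hL.hausdorffMeasure_image_le (d := 2) (by norm_num)
  simp only [Measure.euclideanHausdorffMeasure_def, Measure.smul_apply]
  rw [mul_smul_comm]
  gcongr
  simpa using this

theorem dist_shadow_sq (b : OrthonormalBasis (Fin 3) ℝ E3) (i j : Fin 3) (x y : E3) :
    dist (shadow b i j x) (shadow b i j y) ^ 2 = ⟪b i, x - y⟫ ^ 2 + ⟪b j, x - y⟫ ^ 2 := by
  rw [dist_eq_norm, ← shadow_sub, norm_sq_E2]
  simp

theorem dist_shadow_le (b : OrthonormalBasis (Fin 3) ℝ E3) {i j k : Fin 3} (h : Distinct i j k)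
    (x y : E3) : dist (shadow b i j x) (shadow b i j y) ≤ dist x y := by
  refine le_of_sq_le_sq ?_ dist_nonneg
  rw [dist_shadow_sq, dist_eq_norm x y, norm_sq_frame b h]
  nlinarith [sq_nonneg ⟪b k, x - y⟫]

theorem area_shadow_le (b : OrthonormalBasis (Fin 3) ℝ E3) {i j k : Fin 3} (h : Distinct i j k)
    (A : Set E3) : μHE[2] (shadow b i j '' A) ≤ μHE[2] A := by
  have := area_image_le_of_dist_le (F := shadow b i j) (G := id) (A := A) 1
    (fun x _ y _ => by simpa using dist_shadow_le b h x y)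
  simpa using this

/-- If `(a, b, c)` is a unit vector with `1 / 2 ≤ s c` whose scalar product with `(p, q, r)` is not
positive, then the component `s r` is controlled by the length `N` of `(p, q)`. -/
theorem steep_coord_le {a b c p q r s N : ℝ} (hu : a ^ 2 + b ^ 2 + c ^ 2 = 1) (hN : 0 ≤ N)
    (hN2 : N ^ 2 = p ^ 2 + q ^ 2) (hs : s * s = 1) (hc : 1 / 2 ≤ s * c)
    (h : a * p + b * q + c * r ≤ 0) : s * r ≤ 2 * N := by
  by_contra! hlt
  have h1 : (a * p + b * q) ^ 2 ≤ N ^ 2 := by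
    rw [hN2]
    nlinarith [sq_nonneg (a * q - b * p), sq_nonneg c, mul_nonneg (sq_nonneg c) (sq_nonneg p),
      mul_nonneg (sq_nonneg c) (sq_nonneg q)]
  have h2 := abs_le_of_sq_le_sq' h1 hN
  have h3 : (s * c) * (s * r) = c * r := by linear_combination (c * r) * hs
  nlinarith [h2.1]

/-- A piece of a convex surface whose outer normals make an angle of at most `60` degrees with
`s • b k` is a Lipschitz graph over the plane orthogonal to `b k`. -/
theorem area_le_area_shadow (b : OrthonormalBasis (Fin 3) ℝ E3) {i j k : Fin 3}
    (h : Distinct i j k) {A : Set E3} {s : ℝ} (hs : s * s = 1)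
    (hA : ∀ x ∈ A, ∃ u : E3, ‖u‖ = 1 ∧ 1 / 2 ≤ s * ⟪b k, u⟫ ∧ ∀ y ∈ A, ⟪u, y⟫ ≤ ⟪u, x⟫) :
    μHE[2] A ≤ 9 * μHE[2] (shadow b i j '' A) := by
  have key : ∀ x ∈ A, ∀ y ∈ A,
      s * ⟪b k, y - x⟫ ≤ 2 * dist (shadow b i j x) (shadow b i j y) := by
    intro x hx y hy
    obtain ⟨u, hu, huk, hux⟩ := hA x hx
    have h1 := norm_sq_frame b h u
    rw [hu, one_pow] at h1
    refine steep_coord_le (a := ⟪b i, u⟫) (b := ⟪b j, u⟫) (c := ⟪b k, u⟫) (p := ⟪b i, y - x⟫)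
      (q := ⟪b j, y - x⟫) h1.symm dist_nonneg ?_ hs huk ?_
    · rw [dist_comm, dist_shadow_sq]
    · rw [← inner_frame b h, inner_sub_right]
      linarith [hux y hy]
  have := area_image_le_of_dist_le (F := id) (G := shadow b i j) (A := A) 3 (fun x hx y hy => by
    have h1 := key x hx y hy
    have h2 := key y hy x hx
    have h3 := dist_shadow_sq b i j x y
    have h4 := norm_sq_frame b h (x - y)
    rw [← dist_eq_norm] at h4
    rw [dist_comm (shadow b i j y)] at h2
    rw [← neg_sub x y, inner_neg_right] at h1
    have h5 : ⟪b k, x - y⟫ ^ 2 ≤ (2 * dist (shadow b i j x) (shadow b i j y)) ^ 2 := by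
      have : (s * ⟪b k, x - y⟫) ^ 2 = ⟪b k, x - y⟫ ^ 2 := by
        linear_combination ⟪b k, x - y⟫ ^ 2 * hs
      rw [← this]
      exact sq_le_sq' (by linarith) h2
    have h0 : 0 ≤ dist (shadow b i j x) (shadow b i j y) := dist_nonneg
    simp only [id, NNReal.coe_ofNat]
    refine le_of_sq_le_sq ?_ (by positivity)
    nlinarith)
  rw [image_id] at this
  refine this.trans (le_of_eq ?_)
  norm_num

/-- The coordinate rectangle `I × J` of the Euclidean plane. -/
def rect (I J : Set ℝ) : Set E2 := {x | x 0 ∈ I ∧ x 1 ∈ J}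

theorem area_rect (I J : Set ℝ) : μHE[2] (rect I J) = volume I * volume J := by
  rw [EuclideanSpace.euclideanHausdorffMeasure_eq_volume]
  have h := (EuclideanSpace.volume_preserving_symm_measurableEquiv_toLp (Fin 2)).measure_preimage_equiv
    (univ.pi ![I, J])
  have e : (MeasurableEquiv.toLp 2 (Fin 2 → ℝ)).symm ⁻¹' (univ.pi ![I, J]) = rect I J := by
    ext x
    simp [rect, Fin.forall_fin_two]
  rw [e] at h
  rw [h, volume_pi_pi]
  simp [Fin.prod_univ_two]

/-- The linear map of the plane with the matrix `!![a, b; c, d]`. -/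
noncomputable def planeMap (a b c d : ℝ) : E2 →ₗ[ℝ] E2 :=
  Matrix.toLin (EuclideanSpace.basisFun (Fin 2) ℝ).toBasis
    (EuclideanSpace.basisFun (Fin 2) ℝ).toBasis !![a, b; c, d]

theorem planeMap_apply (a b c d : ℝ) (x : E2) :
    planeMap a b c d x = !₂[a * x 0 + b * x 1, c * x 0 + d * x 1] := by
  have : planeMap a b c d x = Matrix.toEuclideanLin !![a, b; c, d] x := by
    rw [planeMap, Matrix.toEuclideanLin_eq_toLin_orthonormal]
  rw [this]
  ext l
  fin_cases l <;> simp [Matrix.toLpLin_apply, dotProduct, Fin.sum_univ_two]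

theorem area_planeMap_image (a b c d : ℝ) (s : Set E2) :
    μHE[2] (planeMap a b c d '' s) = ENNReal.ofReal |a * d - b * c| * μHE[2] s := by
  rw [EuclideanSpace.euclideanHausdorffMeasure_eq_volume, Measure.addHaar_image_linearMap]
  rw [planeMap, LinearMap.det_toLin, Matrix.det_fin_two_of]

theorem area_parallelogram (a b c d : ℝ) :
    μHE[2] (planeMap a b c d '' rect (Icc 0 (1 / 2)) (Icc 0 (1 / 2))) =
      ENNReal.ofReal (|a * d - b * c| / 4) := by
  rw [area_planeMap_image, area_rect, Real.volume_Icc, ← ENNReal.ofReal_mul (by norm_num),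
    ← ENNReal.ofReal_mul (abs_nonneg _)]
  congr 1
  ring

/-- If the outer normals of a piece of a convex surface are almost orthogonal to `b k`, then the
projection along `b k` contracts its area. The projection factors through the projection along
`b i`, with respect to which the piece is a graph; the map between the two planes is Lipschitz
once the two coordinates orthogonal to `b k` are stretched by `c⁻¹`. -/
theorem area_shadow_le_of_steep (b : OrthonormalBasis (Fin 3) ℝ E3) {i j k : Fin 3}
    (h : Distinct i j k) {A : Set E3} {s c : ℝ} (hs : s * s = 1) (hc : 0 < c)
    (hA : ∀ x ∈ A, ∃ u : E3, ‖u‖ = 1 ∧ 1 / 2 ≤ s * ⟪b i, u⟫ ∧ |⟪b k, u⟫| ≤ c ∧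
      ∀ y ∈ A, ⟪u, y⟫ ≤ ⟪u, x⟫) :
    μHE[2] (shadow b i j '' A) ≤ ENNReal.ofReal (25 * c) * μHE[2] (shadow b k j '' A) := by
  have key : ∀ x ∈ A, ∀ y ∈ A,
      s * ⟪b i, y - x⟫ ≤ 2 * (c * |⟪b k, y - x⟫| + |⟪b j, y - x⟫|) := by
    intro x hx y hy
    obtain ⟨u, hu, hui, huk, hux⟩ := hA x hx
    have h1 := norm_sq_frame b h u
    rw [hu, one_pow] at h1
    have h2 : ⟪u, y - x⟫ ≤ 0 := by rw [inner_sub_right]; linarith [hux y hy]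
    rw [inner_frame b h] at h2
    have hj : |⟪b j, u⟫| ≤ 1 := by
      rw [← sq_le_one_iff_abs_le_one]
      nlinarith [sq_nonneg ⟪b i, u⟫, sq_nonneg ⟪b k, u⟫]
    have h3 : |⟪b k, u⟫ * ⟪b k, y - x⟫| ≤ c * |⟪b k, y - x⟫| := by
      rw [abs_mul]; gcongr
    have h4 : |⟪b j, u⟫ * ⟪b j, y - x⟫| ≤ |⟪b j, y - x⟫| := by
      rw [abs_mul]; exact mul_le_of_le_one_left (abs_nonneg _) hj
    have h5 := neg_abs_le (⟪b k, u⟫ * ⟪b k, y - x⟫)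
    have h6 := neg_abs_le (⟪b j, u⟫ * ⟪b j, y - x⟫)
    have h7 : (s * ⟪b i, u⟫) * (s * ⟪b i, y - x⟫) = ⟪b i, u⟫ * ⟪b i, y - x⟫ := by
      linear_combination (⟪b i, u⟫ * ⟪b i, y - x⟫) * hs
    by_contra! hlt
    have h8 : 0 ≤ c * |⟪b k, y - x⟫| + |⟪b j, y - x⟫| := by positivity
    nlinarith
  have hcomp := area_image_le_of_dist_le
    (F := fun x => planeMap c⁻¹ 0 0 c⁻¹ (shadow b i j x))
    (G := fun x => planeMap 1 0 0 c⁻¹ (shadow b k j x)) (A := A) 5 (fun x hx y hy => by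
    have h1 := key x hx y hy
    have h2 := key y hy x hx
    rw [← neg_sub x y] at h1
    simp only [inner_neg_right, abs_neg] at h1
    have h3 : |⟪b i, x - y⟫| ≤ 2 * (c * |⟪b k, x - y⟫| + |⟪b j, x - y⟫|) := by
      have : |⟪b i, x - y⟫| = |s * ⟪b i, x - y⟫| := by
        rw [abs_mul]
        rcases mul_self_eq_one_iff.1 hs with rfl | rfl <;> simp
      rw [this]
      exact abs_le.2 ⟨by linarith, h2⟩
    refine le_of_sq_le_sq ?_ (by positivity)
    rw [mul_pow, dist_eq_norm, dist_eq_norm, ← map_sub, ← map_sub, ← shadow_sub, ← shadow_sub,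
      norm_sq_E2, norm_sq_E2, planeMap_apply, planeMap_apply]
    simp only [shadow_zero_coord, shadow_one_coord, Matrix.cons_val_zero,
      Matrix.cons_val_one, Matrix.cons_val_fin_one, zero_mul, add_zero, zero_add, one_mul,
      NNReal.coe_ofNat]
    have h4 : c⁻¹ * |⟪b i, x - y⟫| ≤ 2 * (|⟪b k, x - y⟫| + c⁻¹ * |⟪b j, x - y⟫|) := by
      calc c⁻¹ * |⟪b i, x - y⟫| ≤ c⁻¹ * (2 * (c * |⟪b k, x - y⟫| + |⟪b j, x - y⟫|)) := by gcongr
        _ = _ := by field_simp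
    have h5 : 0 ≤ c⁻¹ * |⟪b i, x - y⟫| := by positivity
    rw [← sq_abs (c⁻¹ * _), ← sq_abs (c⁻¹ * ⟪b j, x - y⟫), ← sq_abs ⟪b k, x - y⟫, abs_mul, abs_mul,
      abs_of_pos (inv_pos.2 hc)]
    nlinarith [sq_nonneg (|⟪b k, x - y⟫| - c⁻¹ * |⟪b j, x - y⟫|), sq_nonneg |⟪b k, x - y⟫|,
      sq_nonneg (c⁻¹ * |⟪b j, x - y⟫|)])
  have e1 : (fun x => planeMap c⁻¹ 0 0 c⁻¹ (shadow b i j x)) '' A =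
      planeMap c⁻¹ 0 0 c⁻¹ '' (shadow b i j '' A) := by rw [image_image]
  have e2 : (fun x => planeMap 1 0 0 c⁻¹ (shadow b k j x)) '' A =
      planeMap 1 0 0 c⁻¹ '' (shadow b k j '' A) := by rw [image_image]
  rw [e1, e2, area_planeMap_image, area_planeMap_image] at hcomp
  simp only [mul_zero, sub_zero, one_mul, abs_mul, abs_of_pos (inv_pos.2 hc)] at hcomp
  calc μHE[2] (shadow b i j '' A)
      = ENNReal.ofReal (c * c) * (ENNReal.ofReal (c⁻¹ * c⁻¹) * μHE[2] (shadow b i j '' A)) := by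
        rw [← mul_assoc, ← ENNReal.ofReal_mul (by positivity)]
        rw [show c * c * (c⁻¹ * c⁻¹) = 1 by field_simp, ENNReal.ofReal_one, one_mul]
    _ ≤ ENNReal.ofReal (c * c) * (((5 : ℝ≥0) : ℝ≥0∞) ^ 2 *
          (ENNReal.ofReal c⁻¹ * μHE[2] (shadow b k j '' A))) := by gcongr
    _ = ENNReal.ofReal (25 * c) * μHE[2] (shadow b k j '' A) := by
        have : ((5 : ℝ≥0) : ℝ≥0∞) ^ 2 = ENNReal.ofReal 25 := by
          norm_num
        rw [this, ← mul_assoc, ← mul_assoc, ← ENNReal.ofReal_mul (by positivity),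
          ← ENNReal.ofReal_mul (by positivity)]
        congr 2
        field_simp

/-! ### Areas of subsets of the sphere -/

theorem sphereArea_eq (ω : Set S2) : sphereArea ω = μHE[2] ((↑) '' ω : Set E3) :=
  (isometry_subtype_coe.euclideanHausdorffMeasure_image ω).symm

theorem norm_coe_S2 (u : S2) : ‖(u : E3)‖ = 1 := by simp

theorem coord_sq_sum (b : OrthonormalBasis (Fin 3) ℝ E3) {i j k : Fin 3} (h : Distinct i j k)
    (u : S2) : ⟪b i, (u : E3)⟫ ^ 2 + ⟪b j, (u : E3)⟫ ^ 2 + ⟪b k, (u : E3)⟫ ^ 2 = 1 := by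
  rw [← norm_sq_frame b h, norm_coe_S2, one_pow]

theorem abs_coord_le_norm (b : OrthonormalBasis (Fin 3) ℝ E3) (i : Fin 3) (x : E3) :
    |⟪b i, x⟫| ≤ ‖x‖ := by
  simpa using abs_real_inner_le_norm (b i) x

theorem abs_coord_le_one (b : OrthonormalBasis (Fin 3) ℝ E3) (i : Fin 3) (u : S2) :
    |⟪b i, (u : E3)⟫| ≤ 1 := by
  simpa using abs_coord_le_norm b i (u : E3)

/-- The unit vectors at an angle of at most `60` degrees from `s • b k`, where `s = ± 1`. -/
def cap (b : OrthonormalBasis (Fin 3) ℝ E3) (k : Fin 3) (s : ℝ) : Set S2 :=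
  {u | 1 / 2 ≤ s * ⟪b k, (u : E3)⟫}

/-- The unit vectors whose scalar product with `b k` is at most `δ` in absolute value. -/
def band (b : OrthonormalBasis (Fin 3) ℝ E3) (k : Fin 3) (δ : ℝ) : Set S2 :=
  {u | |⟪b k, (u : E3)⟫| ≤ δ}

theorem isClosed_cap (b : OrthonormalBasis (Fin 3) ℝ E3) (k : Fin 3) (s : ℝ) :
    IsClosed (cap b k s) := isClosed_le (by fun_prop) (by fun_prop)

theorem isClosed_band (b : OrthonormalBasis (Fin 3) ℝ E3) (k : Fin 3) (δ : ℝ) :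
    IsClosed (band b k δ) := isClosed_le (by fun_prop) (by fun_prop)

/-- The four caps around `± b i` and `± b j`. -/
def fourCaps (b : OrthonormalBasis (Fin 3) ℝ E3) (i j : Fin 3) : Set S2 :=
  (cap b i 1 ∪ cap b i (-1)) ∪ (cap b j 1 ∪ cap b j (-1))

theorem band_subset_fourCaps (b : OrthonormalBasis (Fin 3) ℝ E3) {i j k : Fin 3}
    (h : Distinct i j k) {δ : ℝ} (hδ : δ ≤ 1 / 2) : band b k δ ⊆ fourCaps b i j := by
  intro u hu
  have h1 := coord_sq_sum b h u
  have h2 : |⟪b k, (u : E3)⟫| ≤ 1 / 2 := le_trans hu hδ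
  by_contra hn
  simp only [fourCaps, cap, mem_union, Set.mem_ofPred_eq, not_or, not_le] at hn
  obtain ⟨⟨h3, h4⟩, h5, h6⟩ := hn
  rw [abs_le] at h2
  nlinarith

/-- For outer measures as well, so that it applies to `shadowOuter`. -/
theorem measure_le_of_fourCaps {F : Type*} [FunLike F (Set S2) ℝ≥0∞] [OuterMeasureClass F S2]
    {μ : F} (b : OrthonormalBasis (Fin 3) ℝ E3) {i j : Fin 3}
    {ω : Set S2} (hω : ω ⊆ fourCaps b i j) {c : ℝ≥0∞}
    (hi : ∀ s : ℝ, s * s = 1 → μ (ω ∩ cap b i s) ≤ c)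
    (hj : ∀ s : ℝ, s * s = 1 → μ (ω ∩ cap b j s) ≤ c) : μ ω ≤ 4 * c := by
  have h1 : ω = (ω ∩ cap b i 1 ∪ ω ∩ cap b i (-1)) ∪ (ω ∩ cap b j 1 ∪ ω ∩ cap b j (-1)) := by
    rw [← inter_union_distrib_left, ← inter_union_distrib_left, ← inter_union_distrib_left]
    exact (inter_eq_left.2 hω).symm
  calc μ ω ≤ (μ (ω ∩ cap b i 1) + μ (ω ∩ cap b i (-1))) +
        (μ (ω ∩ cap b j 1) + μ (ω ∩ cap b j (-1))) := by
        conv_lhs => rw [h1]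
        exact (measure_union_le _ _).trans
          (add_le_add (measure_union_le _ _) (measure_union_le _ _))
    _ ≤ (c + c) + (c + c) := by
        gcongr
        · exact hi 1 (by norm_num)
        · exact hi (-1) (by norm_num)
        · exact hj 1 (by norm_num)
        · exact hj (-1) (by norm_num)
    _ = 4 * c := by ring

theorem sphereArea_le_area_shadow (b : OrthonormalBasis (Fin 3) ℝ E3) {i j k : Fin 3}
    (h : Distinct i j k) {s : ℝ} (hs : s * s = 1) {ω : Set S2} (hω : ω ⊆ cap b k s) :
    sphereArea ω ≤ 9 * μHE[2] (shadow b i j '' ((↑) '' ω)) := by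
  rw [sphereArea_eq]
  refine area_le_area_shadow b h hs ?_
  rintro _ ⟨u, hu, rfl⟩
  refine ⟨u, norm_coe_S2 u, hω hu, ?_⟩
  rintro _ ⟨v, hv, rfl⟩
  have := real_inner_le_norm (u : E3) v
  rw [real_inner_self_eq_norm_sq]
  simpa using this

theorem sphereArea_cap_inter_le (b : OrthonormalBasis (Fin 3) ℝ E3) {i j k : Fin 3}
    (h : Distinct i j k) {s : ℝ} (hs : s * s = 1) {ω : Set S2} (hω : ω ⊆ cap b k s) {δ : ℝ}
    (hω' : ∀ u ∈ ω, |⟪b j, (u : E3)⟫| ≤ δ) :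
    sphereArea ω ≤ ENNReal.ofReal (36 * δ) := by
  refine (sphereArea_le_area_shadow b h hs hω).trans ?_
  have : shadow b i j '' ((↑) '' ω) ⊆ rect (Icc (-1) 1) (Icc (-δ) δ) := by
    rintro _ ⟨_, ⟨u, hu, rfl⟩, rfl⟩
    simp only [rect, Set.mem_ofPred_eq, shadow_zero_coord, shadow_one_coord, mem_Icc]
    exact ⟨abs_le.1 (abs_coord_le_one b i u), abs_le.1 (hω' u hu)⟩
  calc 9 * μHE[2] (shadow b i j '' ((↑) '' ω))
      ≤ 9 * μHE[2] (rect (Icc (-1) 1) (Icc (-δ) δ)) := by gcongr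
    _ = ENNReal.ofReal (36 * δ) := by
      rw [area_rect, Real.volume_Icc, Real.volume_Icc, ← ENNReal.ofReal_mul (by norm_num),
        show (9 : ℝ≥0∞) = ENNReal.ofReal 9 by norm_num, ← ENNReal.ofReal_mul (by norm_num)]
      congr 1; ring

theorem sphereArea_univ_le : sphereArea univ ≤ ENNReal.ofReal 216 := by
  let b : OrthonormalBasis (Fin 3) ℝ E3 := EuclideanSpace.basisFun (Fin 3) ℝ
  have h : Distinct 0 1 2 := ⟨by decide, by decide, by decide⟩
  have hc : ∀ {i j k : Fin 3}, Distinct i j k → ∀ s : ℝ, s * s = 1 → ∀ ω : Set S2,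
      sphereArea (ω ∩ cap b k s) ≤ ENNReal.ofReal 36 := fun h s hs ω => by
    have := sphereArea_cap_inter_le b h hs (inter_subset_right (s := ω))
      (fun u _ => abs_coord_le_one b _ u)
    rwa [mul_one] at this
  have h1 : sphereArea (band b 2 (1 / 2)) ≤ 4 * ENNReal.ofReal 36 :=
    measure_le_of_fourCaps b (band_subset_fourCaps b h le_rfl)
      (fun s hs => hc h.rotate s hs _) (fun s hs => hc h.rotate.rotate s hs _)
  have h2 : (univ : Set S2) ⊆ band b 2 (1 / 2) ∪ (univ ∩ cap b 2 1 ∪ univ ∩ cap b 2 (-1)) := by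
    intro u _
    by_cases hu : u ∈ band b 2 (1 / 2)
    · exact Or.inl hu
    · right
      simp only [band, cap, Set.mem_ofPred_eq, not_le, univ_inter, mem_union] at hu ⊢
      rcases lt_abs.1 hu with h' | h'
      · left; linarith
      · right; linarith
  calc sphereArea univ ≤ _ := measure_mono h2
    _ ≤ 4 * ENNReal.ofReal 36 + (ENNReal.ofReal 36 + ENNReal.ofReal 36) :=
      (measure_union_le _ _).trans (add_le_add h1 ((measure_union_le _ _).trans
        (add_le_add (hc h 1 (by norm_num) univ) (hc h (-1) (by norm_num) univ))))
    _ = ENNReal.ofReal 216 := by norm_num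

theorem sphereArea_band_le (b : OrthonormalBasis (Fin 3) ℝ E3) {i j k : Fin 3}
    (h : Distinct i j k) {δ : ℝ} (hδ : 0 ≤ δ) :
    sphereArea (band b k δ) ≤ ENNReal.ofReal (432 * δ) := by
  rcases le_total δ (1 / 2) with hδ2 | hδ2
  · have := measure_le_of_fourCaps (μ := sphereArea) b (band_subset_fourCaps b h hδ2)
      (c := ENNReal.ofReal (36 * δ))
      (fun s hs => sphereArea_cap_inter_le b h.rotate hs inter_subset_right fun u hu => hu.1)
      (fun s hs => sphereArea_cap_inter_le b h.swap.rotate hs inter_subset_right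
        fun u hu => hu.1)
    refine this.trans ?_
    rw [show (4 : ℝ≥0∞) = ENNReal.ofReal 4 by norm_num, ← ENNReal.ofReal_mul (by norm_num)]
    exact ENNReal.ofReal_le_ofReal (by linarith)
  · exact (measure_mono (subset_univ _)).trans (sphereArea_univ_le.trans
      (ENNReal.ofReal_le_ofReal (by linarith)))

/-- The part of a cap over a small rectangle has at least the area of the rectangle. -/
theorem area_rect_le_sphereArea (b : OrthonormalBasis (Fin 3) ℝ E3) {i j k : Fin 3}
    (h : Distinct i j k) {s : ℝ} (hs : s * s = 1) {I J : Set ℝ} (hI : I ⊆ Icc (-(1 / 2)) (1 / 2))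
    (hJ : J ⊆ Icc (-(1 / 2)) (1 / 2)) :
    volume I * volume J ≤
      sphereArea (cap b k s ∩ {u | ⟪b i, (u : E3)⟫ ∈ I ∧ ⟪b j, (u : E3)⟫ ∈ J}) := by
  rw [← area_rect, sphereArea_eq]
  refine le_trans (measure_mono ?_) (area_shadow_le b h _)
  rintro y ⟨h0, h1⟩
  have hI' := hI h0
  have hJ' := hJ h1
  have hq : 1 / 4 ≤ 1 - y 0 ^ 2 - y 1 ^ 2 := by nlinarith [hI'.1, hI'.2, hJ'.1, hJ'.2]
  set t := √(1 - y 0 ^ 2 - y 1 ^ 2) with ht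
  have ht2 : t ^ 2 = 1 - y 0 ^ 2 - y 1 ^ 2 := Real.sq_sqrt (by linarith)
  have ht1 : 1 / 2 ≤ t := Real.le_sqrt_of_sq_le (by linarith)
  have ho : ∀ p q : Fin 3, ⟪b p, b q⟫ = if p = q then (1 : ℝ) else 0 :=
    orthonormal_iff_ite.1 b.orthonormal
  set u : E3 := y 0 • b i + y 1 • b j + (s * t) • b k with hu
  have ei : ⟪b i, u⟫ = y 0 := by
    simp [hu, inner_add_right, real_inner_smul_right, ho, h.1, h.2.2]
  have ej : ⟪b j, u⟫ = y 1 := by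
    simp [hu, inner_add_right, real_inner_smul_right, ho, h.1.symm, h.2.1]
  have ek : ⟪b k, u⟫ = s * t := by
    simp [hu, inner_add_right, real_inner_smul_right, ho, h.2.1.symm, h.2.2.symm]
  have hn : ‖u‖ = 1 := by
    have := norm_sq_frame b h u
    rw [ei, ej, ek, mul_pow, ht2, show s ^ 2 = 1 by nlinarith] at this
    rw [← sq_eq_sq₀ (norm_nonneg _) zero_le_one, this]
    ring
  refine ⟨u, ⟨⟨u, by simpa using hn⟩, ⟨?_, ?_, ?_⟩, rfl⟩, ?_⟩
  · change 1 / 2 ≤ s * ⟪b k, u⟫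
    rw [ek, ← mul_assoc, hs, one_mul]
    exact ht1
  · change ⟪b i, u⟫ ∈ I
    rwa [ei]
  · change ⟪b j, u⟫ ∈ J
    rwa [ej]
  · ext l
    fin_cases l
    · simpa using ei
    · simpa using ej

/-! ### Surface area, projections and cone volume -/

theorem inner_le_supportFunction (K : ConvexBody E3) (u : S2) {x : E3} (hx : x ∈ K) :
    ⟪(u : E3), x⟫ ≤ supportFunction K u :=
  le_csSup (K.isCompact.image (by fun_prop)).bddAbove ⟨x, hx, rfl⟩

theorem supportFunction_le (K : ConvexBody E3) (u : S2) {c : ℝ}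
    (h : ∀ x ∈ K, ⟪(u : E3), x⟫ ≤ c) : supportFunction K u ≤ c := by
  refine csSup_le (K.nonempty.image _) ?_
  rintro _ ⟨x, hx, rfl⟩
  exact h x hx

theorem normalPreimage_subset (K : ConvexBody E3) (ω : Set S2) :
    normalPreimage K ω ⊆ K := fun _ hx => K.isClosed.frontier_subset hx.1

theorem surfaceArea_cap_le (K : ConvexBody E3) (hK : (interior (K : Set E3)).Nonempty)
    (b : OrthonormalBasis (Fin 3) ℝ E3) {i j k : Fin 3} (h : Distinct i j k) {s : ℝ}
    (hs : s * s = 1) {ω : Set S2} (hω : ω ⊆ cap b k s) :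
    surfaceAreaMeasure K hK ω ≤ 9 * μHE[2] (shadow b i j '' K) := by
  refine (measure_mono hω).trans ?_
  rw [surfaceAreaMeasure_apply K hK (isClosed_cap b k s).measurableSet]
  refine (area_le_area_shadow b h hs ?_).trans ?_
  · rintro x ⟨hx, u, hu, huω⟩
    exact ⟨u, norm_coe_S2 u, huω, fun y hy => hu y (normalPreimage_subset K _ hy)⟩
  · gcongr
    exact normalPreimage_subset K _

theorem area_shadow_lt_top (K : ConvexBody E3) (b : OrthonormalBasis (Fin 3) ℝ E3)
    (i j : Fin 3) : μHE[2] (shadow b i j '' K) < ∞ := by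
  rw [EuclideanSpace.euclideanHausdorffMeasure_eq_volume]
  exact (K.isCompact.image (continuous_shadow b i j)).measure_lt_top

/-- The set function `ω ↦ H²(P(ν_K⁻¹(ω)))`, where `P` is the projection to a coordinate plane, as
an outer measure. -/
noncomputable def shadowOuter (K : ConvexBody E3) (b : OrthonormalBasis (Fin 3) ℝ E3)
    (i j : Fin 3) : OuterMeasure S2 where
  measureOf ω := μHE[2] (shadow b i j '' normalPreimage K ω)
  empty := by simp [normalPreimage]
  mono h := measure_mono (image_mono (normalPreimage_mono K h))
  iUnion_nat s _ := by
    rw [normalPreimage_iUnion, image_iUnion]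
    exact measure_iUnion_le _

theorem shadowOuter_apply (K : ConvexBody E3) (b : OrthonormalBasis (Fin 3) ℝ E3)
    (i j : Fin 3) (ω : Set S2) :
    shadowOuter K b i j ω = μHE[2] (shadow b i j '' normalPreimage K ω) := rfl

theorem area_shadow_swap_le (b : OrthonormalBasis (Fin 3) ℝ E3) (i j : Fin 3) (A : Set E3) :
    μHE[2] (shadow b i j '' A) ≤ μHE[2] (shadow b j i '' A) := by
  have := area_image_le_of_dist_le (F := shadow b i j) (G := shadow b j i) (A := A) 1
    (fun x _ y _ => by
      rw [NNReal.coe_one, one_mul]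
      refine le_of_sq_le_sq (le_of_eq ?_) dist_nonneg
      rw [dist_shadow_sq, dist_shadow_sq, add_comm])
  simpa using this

theorem shadowOuter_le_surfaceArea (K : ConvexBody E3) (hK : (interior (K : Set E3)).Nonempty)
    (b : OrthonormalBasis (Fin 3) ℝ E3) {i j k : Fin 3} (h : Distinct i j k) {ω : Set S2}
    (hω : MeasurableSet ω) : shadowOuter K b i j ω ≤ surfaceAreaMeasure K hK ω := by
  rw [shadowOuter_apply, surfaceAreaMeasure_apply K hK hω]
  exact area_shadow_le b h _

theorem shadowOuter_le_of_subset_band (K : ConvexBody E3)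
    (hK : (interior (K : Set E3)).Nonempty) (b : OrthonormalBasis (Fin 3) ℝ E3)
    {i j k : Fin 3} (h : Distinct i j k) {ω : Set S2} (hω : MeasurableSet ω) {c : ℝ} (hc : 0 < c)
    (hc' : c ≤ 1 / 2) (hωc : ω ⊆ band b k c) :
    shadowOuter K b i j ω ≤ ENNReal.ofReal (100 * c) * surfaceAreaMeasure K hK ω := by
  have aux : ∀ {i j : Fin 3}, Distinct i j k → ∀ s : ℝ, s * s = 1 →
      shadowOuter K b i j (ω ∩ cap b i s) ≤
        ENNReal.ofReal (25 * c) * surfaceAreaMeasure K hK ω := by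
    intro i j h s hs
    calc shadowOuter K b i j (ω ∩ cap b i s)
        ≤ ENNReal.ofReal (25 * c) * μHE[2] (shadow b k j '' normalPreimage K (ω ∩ cap b i s)) := by
          refine area_shadow_le_of_steep b h hs hc ?_
          rintro x ⟨hx, u, hu, huω⟩
          exact ⟨u, norm_coe_S2 u, huω.2, hωc huω.1,
            fun y hy => hu y (normalPreimage_subset K _ hy)⟩
      _ ≤ ENNReal.ofReal (25 * c) * surfaceAreaMeasure K hK ω := by
          gcongr
          exact (shadowOuter_le_surfaceArea K hK b h.rotate.swap
            (hω.inter (isClosed_cap b i s).measurableSet)).trans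
            (measure_mono inter_subset_left)
  refine (measure_le_of_fourCaps b (hωc.trans (band_subset_fourCaps b h hc'))
    (fun s hs => aux h s hs)
    (fun s hs => (area_shadow_swap_le b i j _).trans (aux h.swap s hs))).trans (le_of_eq ?_)
  rw [← mul_assoc, show (4 : ℝ≥0∞) = ENNReal.ofReal 4 by norm_num,
    ← ENNReal.ofReal_mul (by norm_num)]
  congr 2
  ring

/-- The normals orthogonal to `b k` belong to the contour of the projection along `b k`, which has
area zero: they lie in arbitrarily narrow bands. -/
theorem shadowOuter_equator (K : ConvexBody E3) (hK : (interior (K : Set E3)).Nonempty)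
    (b : OrthonormalBasis (Fin 3) ℝ E3) {i j k : Fin 3} (h : Distinct i j k) :
    shadowOuter K b i j (band b k 0) = 0 := by
  have hfin : surfaceAreaMeasure K hK (band b k 0) ≠ ∞ := by
    refine ne_top_of_le_ne_top ?_ (measure_le_of_fourCaps b
      (band_subset_fourCaps b h (by norm_num))
      (c := max (9 * μHE[2] (shadow b j k '' K)) (9 * μHE[2] (shadow b k i '' K)))
      (fun s hs => (surfaceArea_cap_le K hK b h.rotate hs inter_subset_right).trans
        (le_max_left _ _))
      (fun s hs => (surfaceArea_cap_le K hK b h.rotate.rotate hs inter_subset_right).trans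
        (le_max_right _ _)))
    have h1 := (area_shadow_lt_top K b j k).ne
    have h2 := (area_shadow_lt_top K b k i).ne
    refine ENNReal.mul_ne_top (by norm_num) (ne_of_lt (max_lt ?_ ?_)) <;>
      exact ENNReal.mul_lt_top (by norm_num) (Ne.lt_top ‹_›)
  have hlim : Filter.Tendsto (fun c : ℝ => ENNReal.ofReal (100 * c) *
      surfaceAreaMeasure K hK (band b k 0)) (nhdsWithin 0 (Ioi 0)) (nhds 0) := by
    have h0 : Filter.Tendsto (fun c : ℝ => ENNReal.ofReal (100 * c)) (nhdsWithin 0 (Ioi 0))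
        (nhds 0) := by
      have : Continuous fun c : ℝ => ENNReal.ofReal (100 * c) :=
        ENNReal.continuous_ofReal.comp (by fun_prop)
      simpa using (this.tendsto 0).mono_left nhdsWithin_le_nhds
    simpa using ENNReal.Tendsto.mul_const h0 (Or.inr hfin)
  refine le_antisymm (ge_of_tendsto hlim ?_) bot_le
  filter_upwards [Ioo_mem_nhdsGT (show (0 : ℝ) < 1 / 2 by norm_num)] with c hc
  exact shadowOuter_le_of_subset_band K hK b h (isClosed_band b k 0).measurableSet hc.1 hc.2.le
    fun u hu => le_trans hu hc.1.le

/-- Projecting the part of `∂K` with normals in `B` along `b k` multiplies the element of area by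
at most a constant times the cosine `|u · b k|`. The normals are sorted by the size of this
cosine, and each class is treated by `area_shadow_le_of_steep`. -/
theorem shadowOuter_le_lintegral (K : ConvexBody E3) (hK : (interior (K : Set E3)).Nonempty)
    (b : OrthonormalBasis (Fin 3) ℝ E3) {i j k : Fin 3} (h : Distinct i j k) {B : Set S2}
    (hB : MeasurableSet B) :
    shadowOuter K b i j B ≤
      200 * ∫⁻ u in B, ENNReal.ofReal |⟪b k, (u : E3)⟫| ∂(surfaceAreaMeasure K hK) := by
  set S := surfaceAreaMeasure K hK
  let φ : S2 → ℝ := fun u => |⟪b k, (u : E3)⟫|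
  have hφ : Continuous φ := by fun_prop
  let Bn : ℕ → Set S2 := fun n => B ∩ φ ⁻¹' Ioc ((1 / 2 : ℝ) ^ (n + 1)) ((1 / 2) ^ n)
  have hBn : ∀ n, MeasurableSet (Bn n) := fun n => hB.inter (hφ.measurable measurableSet_Ioc)
  have hdisj : Pairwise (Function.onFun Disjoint Bn) := by
    have hanti : Antitone fun n : ℕ => (1 / 2 : ℝ) ^ n :=
      pow_right_anti₀ (by norm_num) (by norm_num)
    intro m n hmn
    exact ((hanti.pairwise_disjoint_on_Ioc_succ hmn).preimage φ).mono inter_subset_right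
      inter_subset_right
  have hcover : B ⊆ band b k 0 ∪ ⋃ n, Bn n := by
    intro u hu
    rcases (abs_nonneg ⟪b k, (u : E3)⟫).eq_or_lt with h0 | h0
    · exact Or.inl h0.symm.le
    · obtain ⟨n, hn⟩ := exists_nat_pow_near_of_lt_one h0 (abs_coord_le_one b k u)
        (show (0 : ℝ) < 1 / 2 by norm_num) (by norm_num)
      exact Or.inr (mem_iUnion.2 ⟨n, hu, hn⟩)
  have hpiece : ∀ n, shadowOuter K b i j (Bn n) ≤
      200 * ∫⁻ u in Bn n, ENNReal.ofReal (φ u) ∂S := by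
    intro n
    have h1 : ENNReal.ofReal ((1 / 2) ^ (n + 1)) * S (Bn n) ≤
        ∫⁻ u in Bn n, ENNReal.ofReal (φ u) ∂S := by
      rw [← setLIntegral_const]
      exact setLIntegral_mono' (hBn n) fun u hu => ENNReal.ofReal_le_ofReal hu.2.1.le
    have h2 : shadowOuter K b i j (Bn n) ≤ ENNReal.ofReal (100 * (1 / 2) ^ n) * S (Bn n) := by
      rcases n with _ | n
      · refine (shadowOuter_le_surfaceArea K hK b h (hBn 0)).trans
          (le_mul_of_one_le_left bot_le ?_)
        rw [← ENNReal.ofReal_one]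
        exact ENNReal.ofReal_le_ofReal (by norm_num)
      · refine shadowOuter_le_of_subset_band K hK b h (hBn _) (by positivity) ?_
          fun u hu => hu.2.2
        rw [pow_succ]
        have : (1 / 2 : ℝ) ^ n ≤ 1 := pow_le_one₀ (by norm_num) (by norm_num)
        linarith
    refine h2.trans (le_trans (le_of_eq ?_) (mul_le_mul_right h1 200))
    rw [← mul_assoc, show (200 : ℝ≥0∞) = ENNReal.ofReal 200 by norm_num,
      ← ENNReal.ofReal_mul (by norm_num)]
    congr 2
    ring
  calc shadowOuter K b i j B
      ≤ shadowOuter K b i j (band b k 0) + ∑' n, shadowOuter K b i j (Bn n) :=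
        (measure_mono hcover).trans ((measure_union_le _ _).trans
          (by gcongr; exact measure_iUnion_le _))
    _ ≤ 0 + ∑' n, 200 * ∫⁻ u in Bn n, ENNReal.ofReal (φ u) ∂S := by
        gcongr with n
        · exact (shadowOuter_equator K hK b h).le
        · exact hpiece n
    _ = 200 * ∫⁻ u in ⋃ n, Bn n, ENNReal.ofReal (φ u) ∂S := by
        rw [zero_add, ENNReal.tsum_mul_left, lintegral_iUnion hBn hdisj]
    _ ≤ 200 * ∫⁻ u in B, ENNReal.ofReal (φ u) ∂S := by
        gcongr
        exact iUnion_subset fun n => inter_subset_left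

open scoped Pointwise in
/-- The end point of a chord of `K` in the direction `v` has an outer normal that makes an angle
of at most `90` degrees with `v`: it supports the convex set `K - [0, ∞) v` as well. -/
theorem exists_normal_at_end (K : ConvexBody E3) (hK : (interior (K : Set E3)).Nonempty) (v x : E3)
    (hx : x ∈ K) (hend : ∀ t : ℝ, 0 < t → x + t • v ∉ K) :
    x ∈ frontier (K : Set E3) ∧ ∃ u ∈ normalMap K x, 0 ≤ ⟪(u : E3), v⟫ := by
  let V : Set E3 := (K : Set E3) + (fun t : ℝ => t • (-v)) '' Ici 0
  have hVconv : Convex ℝ V := by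
    refine K.convex.add ?_
    exact (convex_Ici (0 : ℝ)).is_linear_image (IsLinearMap.isLinearMap_smul' (-v))
  have hKV : (K : Set E3) ⊆ V := fun y hy =>
    ⟨y, hy, 0, ⟨0, by simp, by simp⟩, by simp⟩
  have hVint : (interior V).Nonempty := hK.mono (interior_mono hKV)
  have hxV : x ∉ interior V := by
    intro hxi
    have hlim : Filter.Tendsto (fun t : ℝ => x + t • v) (nhdsWithin 0 (Ioi 0)) (nhds x) := by
      have : Continuous fun t : ℝ => x + t • v := by fun_prop
      simpa using (this.tendsto 0).mono_left nhdsWithin_le_nhds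
    obtain ⟨t, ht, ht0⟩ := ((hlim.eventually (isOpen_interior.mem_nhds hxi)).and
      self_mem_nhdsWithin).exists
    obtain ⟨y, hy, _, ⟨r, hr, rfl⟩, hyr⟩ := interior_subset ht
    have ht0' : 0 < t := ht0
    have hr' : 0 ≤ r := hr
    refine hend (t + r) (by linarith) ?_
    have : x + (t + r) • v = y := by
      rw [add_smul, ← add_assoc, ← hyr]
      simp
    rw [this]
    exact hy
  obtain ⟨f, hf⟩ := geometric_hahn_banach_open_point hVconv.interior isOpen_interior hxV
  have hfV : ∀ y ∈ V, f y ≤ f x := by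
    intro y hy
    have hcl : y ∈ closure (interior V) := by
      rw [hVconv.closure_interior_eq_closure_of_nonempty_interior hVint]
      exact subset_closure hy
    exact closure_minimal (fun z hz => (hf z hz).le)
      (isClosed_le f.continuous continuous_const) hcl
  let w : E3 := (InnerProductSpace.toDual ℝ E3).symm f
  have hw : ∀ y, ⟪w, y⟫ = f y := fun y => InnerProductSpace.toDual_symm_apply
  have hw0 : w ≠ 0 := by
    intro h0
    obtain ⟨y, hy⟩ := hVint
    have := hf y hy
    rw [← hw, ← hw, h0, inner_zero_left, inner_zero_left] at this
    exact lt_irrefl _ this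
  have hwpos : 0 < ‖w‖ := norm_pos_iff.2 hw0
  refine ⟨⟨subset_closure hx, fun hxi => hxV (interior_mono hKV hxi)⟩,
    ⟨‖w‖⁻¹ • w, by simp [norm_smul, hwpos.ne']⟩, ?_, ?_⟩
  · intro z hz
    change ⟪‖w‖⁻¹ • w, z⟫ ≤ ⟪‖w‖⁻¹ • w, x⟫
    rw [real_inner_smul_left, real_inner_smul_left, hw, hw]
    exact mul_le_mul_of_nonneg_left (hfV z (hKV hz)) (inv_nonneg.2 hwpos.le)
  · change 0 ≤ ⟪‖w‖⁻¹ • w, v⟫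
    rw [real_inner_smul_left]
    refine mul_nonneg (inv_nonneg.2 hwpos.le) ?_
    have := hfV (x + (1 : ℝ) • (-v)) ⟨x, hx, _, ⟨1, by simp, rfl⟩, rfl⟩
    rw [← hw, ← hw, inner_add_right, one_smul, inner_neg_right] at this
    linarith

/-- The basic lower bound for the cone-volume measure. If `K` contains `g • b k`, then a boundary
point over `D` with normal `u` has `h_K(u) ≥ g (u · b k)`, while `(u · b k) dS_K` dominates the
area of the projection along `b k`. -/
theorem chord_mul_area_le (K : ConvexBody E3) (hK : (interior (K : Set E3)).Nonempty)
    (b : OrthonormalBasis (Fin 3) ℝ E3) {i j k : Fin 3} (h : Distinct i j k) {g : ℝ}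
    (hg : g • b k ∈ K) {D : Set E2} (hD : D ⊆ shadow b i j '' K) {ω : Set S2}
    (hω : MeasurableSet ω)
    (hn : ∀ x ∈ frontier (K : Set E3), shadow b i j x ∈ D → normalMap K x ⊆ ω) :
    ENNReal.ofReal |g| * μHE[2] D ≤ 200 * supportSurfaceMeasure K hK ω := by
  obtain ⟨s, hs, hsg⟩ : ∃ s : ℝ, s * s = 1 ∧ s * g = |g| := by
    rcases le_total 0 g with h0 | h0
    · exact ⟨1, by norm_num, by rw [abs_of_nonneg h0, one_mul]⟩
    · exact ⟨-1, by norm_num, by rw [abs_of_nonpos h0]; ring⟩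
  let B : Set S2 := ω ∩ {u | 0 ≤ s * ⟪b k, (u : E3)⟫}
  have hBm : MeasurableSet B :=
    hω.inter (isClosed_le continuous_const (by fun_prop)).measurableSet
  have hcover : D ⊆ shadow b i j '' normalPreimage K B := by
    intro d hd
    obtain ⟨x₀, hx₀, hx₀d⟩ := hD hd
    have hcomp : IsCompact ((K : Set E3) ∩ shadow b i j ⁻¹' {d}) :=
      K.isCompact.inter_right (isClosed_singleton.preimage (continuous_shadow b i j))
    obtain ⟨x, ⟨hxK, hxd⟩, hmax⟩ := hcomp.exists_isMaxOn ⟨x₀, hx₀, hx₀d⟩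
      (f := fun x => s * ⟪b k, x⟫) (by fun_prop)
    have ho : ∀ p q : Fin 3, ⟪b p, b q⟫ = if p = q then (1 : ℝ) else 0 :=
      orthonormal_iff_ite.1 b.orthonormal
    obtain ⟨hxf, u, hu, hus⟩ := exists_normal_at_end K hK (s • b k) x hxK (by
      intro t ht hmem
      have hsh : shadow b i j (x + t • s • b k) = d := by
        rw [← mem_singleton_iff.1 hxd]
        ext l
        fin_cases l <;>
          simp [inner_add_right, real_inner_smul_right, ho, h.2.1, h.2.2]
      have := hmax (show x + t • s • b k ∈ (K : Set E3) ∩ shadow b i j ⁻¹' {d} from ⟨hmem, hsh⟩)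
      simp only [Set.mem_ofPred_eq, inner_add_right, real_inner_smul_right, ho, if_true] at this
      nlinarith)
    refine ⟨x, ⟨hxf, u, hu, hn x hxf ?_ hu, ?_⟩, hxd⟩
    · rw [mem_singleton_iff.1 hxd]; exact hd
    · rw [real_inner_smul_right, real_inner_comm] at hus
      exact hus
  calc ENNReal.ofReal |g| * μHE[2] D
      ≤ ENNReal.ofReal |g| * (200 * ∫⁻ u in B, ENNReal.ofReal |⟪b k, (u : E3)⟫|
          ∂(surfaceAreaMeasure K hK)) := by
        gcongr
        exact (measure_mono hcover).trans (shadowOuter_le_lintegral K hK b h hBm)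
    _ = 200 * ∫⁻ u in B, ENNReal.ofReal |g| * ENNReal.ofReal |⟪b k, (u : E3)⟫|
          ∂(surfaceAreaMeasure K hK) := by
        rw [lintegral_const_mul' _ _ ENNReal.ofReal_ne_top]
        ring
    _ ≤ 200 * ∫⁻ u in B, ENNReal.ofReal (supportFunction K u) ∂(surfaceAreaMeasure K hK) := by
        gcongr 200 * ?_
        refine setLIntegral_mono' hBm fun u hu => ?_
        rw [← ENNReal.ofReal_mul (abs_nonneg _)]
        refine ENNReal.ofReal_le_ofReal (le_trans (le_of_eq ?_)
          (inner_le_supportFunction K u hg))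
        have h0 : 0 ≤ s * ⟪b k, (u : E3)⟫ := hu.2
        have h1 : |⟪b k, (u : E3)⟫| = s * ⟪b k, (u : E3)⟫ := by
          rw [← abs_of_nonneg h0, abs_mul]
          rcases mul_self_eq_one_iff.1 hs with rfl | rfl <;> simp
        rw [h1, ← hsg, real_inner_smul_right, real_inner_comm]
        linear_combination (g * ⟪(u : E3), b k⟫) * hs
    _ = 200 * supportSurfaceMeasure K hK B := by
        rw [supportSurfaceMeasure, withDensity_apply _ hBm]
    _ ≤ 200 * supportSurfaceMeasure K hK ω := by
        gcongr
        exact inter_subset_left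

/-! ### Bodies whose cone-volume measure is comparable to spherical area -/

/-- The measure `h_K dS_K` is bounded above and below by multiples of the area measure of the
sphere. -/
def IsComparable (lam : ℝ) (K : ConvexBody E3) (hK : (interior (K : Set E3)).Nonempty) : Prop :=
  ∀ ω, MeasurableSet ω → ENNReal.ofReal (1 / lam) * sphereArea ω ≤ supportSurfaceMeasure K hK ω ∧
    supportSurfaceMeasure K hK ω ≤ ENNReal.ofReal lam * sphereArea ω

theorem isComparable_of_density {lam : ℝ} {K : ConvexBody E3}
    {hK : (interior (K : Set E3)).Nonempty} {f : S2 → ℝ} (hf : ∀ u, 1 / lam < f u ∧ f u < lam)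
    (h : supportSurfaceMeasure K hK =
      sphereArea.withDensity (fun u => ENNReal.ofReal (f u))) : IsComparable lam K hK := by
  intro ω hω
  rw [h, withDensity_apply _ hω, ← setLIntegral_const, ← setLIntegral_const]
  exact ⟨setLIntegral_mono' hω fun u _ => ENNReal.ofReal_le_ofReal (hf u).1.le,
    setLIntegral_mono' hω fun u _ => ENNReal.ofReal_le_ofReal (hf u).2.le⟩

/-- Where the support function is small, the surface area measure is large. -/
theorem sphereArea_le_surfaceArea {lam : ℝ} (hlam : 0 < lam) {K : ConvexBody E3}
    {hK : (interior (K : Set E3)).Nonempty} (hc : IsComparable lam K hK) {ω : Set S2}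
    (hω : MeasurableSet ω) {H : ℝ} (hH : ∀ u ∈ ω, supportFunction K u ≤ H) :
    sphereArea ω ≤ ENNReal.ofReal (lam * H) * surfaceAreaMeasure K hK ω := by
  have h1 : supportSurfaceMeasure K hK ω ≤ ENNReal.ofReal H * surfaceAreaMeasure K hK ω := by
    rw [supportSurfaceMeasure, withDensity_apply _ hω, ← setLIntegral_const]
    exact setLIntegral_mono' hω fun u hu => ENNReal.ofReal_le_ofReal (hH u hu)
  calc sphereArea ω = ENNReal.ofReal lam * (ENNReal.ofReal (1 / lam) * sphereArea ω) := by
        rw [← mul_assoc, ← ENNReal.ofReal_mul hlam.le, mul_one_div_cancel hlam.ne',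
          ENNReal.ofReal_one, one_mul]
    _ ≤ ENNReal.ofReal lam * (ENNReal.ofReal H * surfaceAreaMeasure K hK ω) := by
        gcongr ENNReal.ofReal lam * ?_
        exact (hc ω hω).1.trans h1
    _ = ENNReal.ofReal (lam * H) * surfaceAreaMeasure K hK ω := by
        rw [← mul_assoc, ENNReal.ofReal_mul hlam.le]

/-- The area of the projection of `K` to the plane spanned by `b i` and `b j`. -/
noncomputable def shadowArea (K : ConvexBody E3) (b : OrthonormalBasis (Fin 3) ℝ E3)
    (i j : Fin 3) : ℝ := (μHE[2] (shadow b i j '' K)).toReal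

theorem ofReal_shadowArea (K : ConvexBody E3) (b : OrthonormalBasis (Fin 3) ℝ E3)
    (i j : Fin 3) : ENNReal.ofReal (shadowArea K b i j) = μHE[2] (shadow b i j '' K) :=
  ENNReal.ofReal_toReal (area_shadow_lt_top K b i j).ne

theorem shadowArea_nonneg (K : ConvexBody E3) (b : OrthonormalBasis (Fin 3) ℝ E3)
    (i j : Fin 3) : 0 ≤ shadowArea K b i j := ENNReal.toReal_nonneg

theorem shadowArea_le (K : ConvexBody E3) (b : OrthonormalBasis (Fin 3) ℝ E3) (i j : Fin 3)
    {α β : ℝ} (hα : 0 ≤ α) (hβ : 0 ≤ β) (hi : ∀ x ∈ K, |⟪b i, x⟫| ≤ α)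
    (hj : ∀ x ∈ K, |⟪b j, x⟫| ≤ β) : shadowArea K b i j ≤ 4 * α * β := by
  have h1 : shadow b i j '' K ⊆ rect (Icc (-α) α) (Icc (-β) β) := by
    rintro _ ⟨x, hx, rfl⟩
    simp only [rect, Set.mem_ofPred_eq, shadow_zero_coord, shadow_one_coord, mem_Icc]
    exact ⟨abs_le.1 (hi x hx), abs_le.1 (hj x hx)⟩
  refine ENNReal.toReal_le_of_le_ofReal (by positivity) ((measure_mono h1).trans (le_of_eq ?_))
  rw [area_rect, Real.volume_Icc, Real.volume_Icc, ← ENNReal.ofReal_mul (by linarith)]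
  congr 1
  ring

theorem chord_mul_shadowArea_le {lam : ℝ} (hlam : 0 < lam) {K : ConvexBody E3}
    {hK : (interior (K : Set E3)).Nonempty} (hc : IsComparable lam K hK)
    (b : OrthonormalBasis (Fin 3) ℝ E3) {i j k : Fin 3} (h : Distinct i j k) {g : ℝ}
    (hg : g • b k ∈ K) : |g| * shadowArea K b i j ≤ 43200 * lam := by
  have h1 := chord_mul_area_le K hK b h hg subset_rfl MeasurableSet.univ
    (fun x _ _ => subset_univ _)
  rw [← ofReal_shadowArea, ← ENNReal.ofReal_mul (abs_nonneg _)] at h1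
  refine (ENNReal.ofReal_le_ofReal_iff (by positivity)).1 (h1.trans ?_)
  calc 200 * supportSurfaceMeasure K hK univ
      ≤ 200 * (ENNReal.ofReal lam * ENNReal.ofReal 216) := by
        gcongr
        exact (hc univ MeasurableSet.univ).2.trans (by gcongr; exact sphereArea_univ_le)
    _ = ENNReal.ofReal (43200 * lam) := by
        rw [show (200 : ℝ≥0∞) = ENNReal.ofReal 200 by norm_num, ← ENNReal.ofReal_mul hlam.le,
          ← ENNReal.ofReal_mul (by norm_num)]
        congr 1
        ring

/-- If all normals at the boundary points over `D` are nearly orthogonal to a fixed vector, then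
the cone-volume measure of the set of these normals is small. -/
theorem chord_mul_area_le_of_band {lam : ℝ} (hlam : 0 < lam) {K : ConvexBody E3}
    {hK : (interior (K : Set E3)).Nonempty} (hc : IsComparable lam K hK)
    (b : OrthonormalBasis (Fin 3) ℝ E3) {i j k i' j' k' : Fin 3} (h : Distinct i j k)
    (h' : Distinct i' j' k') {g : ℝ} (hg : g • b k ∈ K) {D : Set E2}
    (hD : D ⊆ shadow b i j '' K) {δ : ℝ} (hδ : 0 ≤ δ)
    (hn : ∀ x ∈ K, shadow b i j x ∈ D → ∀ u ∈ normalMap K x, |⟪b k', (u : E3)⟫| ≤ δ)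
    {a : ℝ} (ha : ENNReal.ofReal a ≤ μHE[2] D) :
    |g| * a ≤ 86400 * lam * δ := by
  have h1 := chord_mul_area_le K hK b h hg hD (isClosed_band b k' δ).measurableSet
    (fun x hx hxD u hu => hn x (K.isClosed.frontier_subset hx) hxD u hu)
  refine (ENNReal.ofReal_le_ofReal_iff (by positivity)).1 ?_
  calc ENNReal.ofReal (|g| * a) ≤ ENNReal.ofReal |g| * μHE[2] D := by
        rw [ENNReal.ofReal_mul (abs_nonneg _)]
        gcongr
    _ ≤ 200 * (ENNReal.ofReal lam * ENNReal.ofReal (432 * δ)) := by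
        refine h1.trans ?_
        gcongr
        refine (hc _ (isClosed_band b k' δ).measurableSet).2.trans ?_
        gcongr
        exact sphereArea_band_le b h' hδ
    _ = ENNReal.ofReal (86400 * lam * δ) := by
        rw [show (200 : ℝ≥0∞) = ENNReal.ofReal 200 by norm_num, ← ENNReal.ofReal_mul hlam.le,
          ← ENNReal.ofReal_mul (by norm_num)]
        congr 1
        ring

theorem norm_shadow_sq (b : OrthonormalBasis (Fin 3) ℝ E3) {i j k : Fin 3} (h : Distinct i j k)
    (x : E3) : ‖shadow b i j x‖ ^ 2 = ‖x‖ ^ 2 - ⟪b k, x⟫ ^ 2 := by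
  rw [norm_sq_E2, norm_sq_frame b h]
  simp

theorem shadow_comb (b : OrthonormalBasis (Fin 3) ℝ E3) (i j : Fin 3) (x y : E3) (α β : ℝ) :
    shadow b i j (α • x + β • y) = α • shadow b i j x + β • shadow b i j y := by
  ext l
  fin_cases l <;> simp [inner_add_right, real_inner_smul_right]

theorem abs_coord_le_norm_E2 (y : E2) : |y 0| ≤ ‖y‖ ∧ |y 1| ≤ ‖y‖ := by
  have := norm_sq_E2 y
  constructor <;> refine abs_le_of_sq_le_sq ?_ (norm_nonneg _) <;>
    nlinarith [sq_nonneg (y 0), sq_nonneg (y 1)]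

theorem inner_le_of_shadow (b : OrthonormalBasis (Fin 3) ℝ E3) {i j k : Fin 3}
    (h : Distinct i j k) (u : S2) (x : E3) :
    |⟪(u : E3), x⟫ - ⟪b k, (u : E3)⟫ * ⟪b k, x⟫| ≤ ‖shadow b i j x‖ := by
  have hx := norm_sq_E2 (shadow b i j x)
  simp only [shadow_zero_coord, shadow_one_coord] at hx
  have hu := coord_sq_sum b h u
  refine abs_le_of_sq_le_sq ?_ (norm_nonneg _)
  rw [inner_frame b h, hx]
  have h1 : 0 ≤ ⟪b k, (u : E3)⟫ ^ 2 * (⟪b i, x⟫ ^ 2 + ⟪b j, x⟫ ^ 2) := by positivity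
  have h2 := sq_nonneg (⟪b i, (u : E3)⟫ * ⟪b j, x⟫ - ⟪b j, (u : E3)⟫ * ⟪b i, x⟫)
  have h3 : ⟪b k, (u : E3)⟫ ^ 2 = 1 - ⟪b i, (u : E3)⟫ ^ 2 - ⟪b j, (u : E3)⟫ ^ 2 := by linarith
  rw [h3] at h1
  nlinarith

theorem exists_frame {i j : Fin 3} (hij : i ≠ j) {u v : E3} (hu : ‖u‖ = 1) (hv : ‖v‖ = 1)
    (huv : ⟪u, v⟫ = 0) : ∃ b : OrthonormalBasis (Fin 3) ℝ E3, b i = u ∧ b j = v := by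
  let f : Fin 3 → E3 := fun l => if l = i then u else v
  have hf : Orthonormal ℝ (({i, j} : Set (Fin 3)).domRestrict f) := by
    rw [orthonormal_iff_ite]
    have hvu : ⟪v, u⟫ = 0 := by rw [real_inner_comm, huv]
    rintro ⟨p, rfl | rfl⟩ ⟨q, rfl | rfl⟩ <;>
      simp [f, Set.domRestrict, hij, hij.symm, hu, hv, huv, hvu, Subtype.ext_iff]
  obtain ⟨b, hb⟩ := hf.exists_orthonormalBasis_extension_of_card_eq (by simp)
  exact ⟨b, by simpa [f] using hb i (by simp), by simpa [f, hij.symm] using hb j (by simp)⟩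

theorem comb_mem {K : ConvexBody E3} {x y : E3} (hx : x ∈ K) (hy : y ∈ K) {α β : ℝ}
    (hα : 0 ≤ α) (hβ : 0 ≤ β) (h : α + β = 1) : α • x + β • y ∈ K :=
  K.convex hx hy hα hβ h

theorem comb_mem_of_zero_mem {K : ConvexBody E3} (h0 : (0 : E3) ∈ K) {x y : E3} (hx : x ∈ K)
    (hy : y ∈ K) {α β : ℝ} (hα : 0 ≤ α) (hβ : 0 ≤ β) (h : α + β ≤ 1) :
    α • x + β • y ∈ K := by
  have := K.convex.sum_mem (t := Finset.univ) (w := ![α, β, 1 - α - β]) (z := ![x, y, 0])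
    (by intro l _; fin_cases l <;> simp <;> linarith)
    (by simp [Fin.sum_univ_three])
    (by intro l _; fin_cases l <;> simpa)
  simpa [Fin.sum_univ_three] using this

/-- If `K` is thin orthogonally to `b k` and reaches only to the depth `L` below the origin, then
its support function is small on the lower hemisphere, and so its surface area there is large;
this area is comparable to the area of the projection along `b k`. -/
theorem one_le_depth_mul_shadowArea {lam : ℝ} (hlam : 0 < lam) {K : ConvexBody E3}
    {hK : (interior (K : Set E3)).Nonempty} (hc : IsComparable lam K hK)
    (b : OrthonormalBasis (Fin 3) ℝ E3) {i j k : Fin 3} (h : Distinct i j k) {L r : ℝ}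
    (hL : 0 ≤ L) (hxL : ∀ x ∈ K, -L ≤ ⟪b k, x⟫) (hr : ∀ x ∈ K, ‖shadow b i j x‖ ≤ r) :
    1 ≤ 9 * lam * (L + r) * shadowArea K b i j := by
  have hr0 : 0 ≤ r := by
    obtain ⟨x, hx⟩ := K.nonempty
    exact (norm_nonneg _).trans (hr x hx)
  have h1 := area_rect_le_sphereArea b h (s := -1) (by norm_num)
    (Subset.refl (Icc (-(1 / 2)) (1 / 2)))
    (Subset.refl (Icc (-(1 / 2)) (1 / 2)))
  have h2 := sphereArea_le_surfaceArea hlam hc (isClosed_cap b k (-1)).measurableSet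
    (H := L + r) (by
      intro u hu
      refine supportFunction_le K u fun x hx => ?_
      have h3 := (abs_le.1 (inner_le_of_shadow b h u x)).2
      have h4 : 1 / 2 ≤ -1 * ⟪b k, (u : E3)⟫ := hu
      have h5 := (abs_le.1 (abs_coord_le_one b k u)).1
      have h6 := hxL x hx
      have h7 := hr x hx
      nlinarith)
  have h3 := surfaceArea_cap_le K hK b h (s := -1) (by norm_num) (Subset.refl (cap b k (-1)))
  rw [← ofReal_shadowArea] at h3
  have h4 : ENNReal.ofReal 1 ≤ ENNReal.ofReal (9 * lam * (L + r) * shadowArea K b i j) := by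
    calc ENNReal.ofReal 1 = volume (Icc (-(1 / 2) : ℝ) (1 / 2)) *
          volume (Icc (-(1 / 2) : ℝ) (1 / 2)) := by
          rw [Real.volume_Icc]; norm_num
      _ ≤ sphereArea (cap b k (-1)) := h1.trans (measure_mono inter_subset_left)
      _ ≤ ENNReal.ofReal (lam * (L + r)) * (9 * ENNReal.ofReal (shadowArea K b i j)) := by
          refine h2.trans ?_
          gcongr
      _ = ENNReal.ofReal (9 * lam * (L + r) * shadowArea K b i j) := by
          have := shadowArea_nonneg K b i j
          rw [show (9 : ℝ≥0∞) = ENNReal.ofReal 9 by norm_num, ← ENNReal.ofReal_mul (by norm_num),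
            ← ENNReal.ofReal_mul (by positivity)]
          congr 1
          ring
  refine (ENNReal.ofReal_le_ofReal_iff ?_).1 h4
  have := shadowArea_nonneg K b i j
  positivity

/-! ### Needles -/

/-- A body that is deep on both sides of the origin in the direction `b 2` has a section through
the origin that is not much smaller than its projection. -/
theorem exists_section_point {K : ConvexBody E3} (b : OrthonormalBasis (Fin 3) ℝ E3)
    {R r c L : ℝ} (hR : 0 < R) (hc0 : 0 < c) (hc1 : c ≤ 1) (hr : 0 ≤ r)
    (hp : R • b 2 ∈ K) (hxR : ∀ x ∈ K, ‖x‖ ≤ R) {q m : E3} (hq : q ∈ K) (hm : m ∈ K)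
    (hqr : ‖shadow b 0 1 q‖ = r) (hmL : ⟪b 2, m⟫ = -L) (hL : c * R ≤ L) :
    ∃ z ∈ K, ⟪b 2, z⟫ = 0 ∧ c * r / 8 ≤ ‖z‖ := by
  have h : Distinct 0 1 2 := ⟨by decide, by decide, by decide⟩
  have hL0 : 0 < L := lt_of_lt_of_le (by positivity) hL
  have hLR : L ≤ R := by
    have := (abs_le.1 ((abs_coord_le_norm b 2 m).trans (hxR m hm))).1
    linarith
  have hqR := abs_le.1 ((abs_coord_le_norm b 2 q).trans (hxR q hq))
  have hnorm : ∀ z : E3, ‖shadow b 0 1 z‖ ≤ ‖z‖ := fun z => by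
    refine le_of_sq_le_sq ?_ (norm_nonneg _)
    rw [norm_shadow_sq b h]
    nlinarith [sq_nonneg ⟪b 2, z⟫]
  have ho : ∀ p q : Fin 3, ⟪b p, b q⟫ = if p = q then (1 : ℝ) else 0 :=
    orthonormal_iff_ite.1 b.orthonormal
  have hsp : shadow b 0 1 (R • b 2) = 0 := by
    ext l
    fin_cases l <;> simp [real_inner_smul_right, ho]
  -- a combination of `x` below the origin with the top point
  have hdown : ∀ x ∈ K, ⟪b 2, x⟫ ≤ 0 → ∃ z ∈ K, ⟪b 2, z⟫ = 0 ∧ ‖shadow b 0 1 x‖ / 2 ≤ ‖z‖ := by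
    intro x hx hx0
    have hxR' := (abs_le.1 ((abs_coord_le_norm b 2 x).trans (hxR x hx))).1
    set d := R - ⟪b 2, x⟫ with hd
    have hd0 : 0 < d := by linarith
    refine ⟨(R / d) • x + (-⟪b 2, x⟫ / d) • R • b 2, comb_mem hx hp (by positivity)
      (div_nonneg (by linarith) hd0.le) ?_, ?_, ?_⟩
    · rw [← add_div, ← sub_eq_add_neg, ← hd, div_self hd0.ne']
    · simp only [inner_add_right, real_inner_smul_right, ho, if_true]
      field_simp
      ring
    · refine le_trans ?_ (hnorm _)
      rw [shadow_comb, hsp, smul_zero, add_zero, norm_smul, Real.norm_eq_abs,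
        abs_of_pos (by positivity)]
      have : 1 / 2 ≤ R / d := by
        rw [div_le_div_iff₀ (by norm_num) hd0]
        linarith
      nlinarith [norm_nonneg (shadow b 0 1 x)]
  have hcr : c * r ≤ r := mul_le_of_le_one_left hr hc1
  rcases le_or_gt ⟪b 2, q⟫ 0 with hq0 | hq0
  · obtain ⟨z, hz, hz0, hzq⟩ := hdown q hq hq0
    refine ⟨z, hz, hz0, ?_⟩
    rw [hqr] at hzq
    linarith
  rcases le_or_gt (c * r / 4) ‖shadow b 0 1 m‖ with hms | hms
  · obtain ⟨z, hz, hz0, hzm⟩ := hdown m hm (by linarith)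
    exact ⟨z, hz, hz0, by linarith⟩
  · set t := ⟪b 2, q⟫ with ht
    have hd0 : 0 < L + t := by linarith
    refine ⟨(L / (L + t)) • q + (t / (L + t)) • m, comb_mem hq hm (by positivity)
      (by positivity) (by field_simp), ?_, ?_⟩
    · simp only [inner_add_right, real_inner_smul_right, hmL, ← ht]
      field_simp
      ring
    · refine le_trans ?_ (hnorm _)
      rw [shadow_comb]
      have h1 := norm_sub_norm_le ((L / (L + t)) • shadow b 0 1 q)
        (-((t / (L + t)) • shadow b 0 1 m))
      rw [sub_neg_eq_add, norm_neg, norm_smul, norm_smul, Real.norm_eq_abs, Real.norm_eq_abs,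
        abs_of_pos (by positivity), abs_of_pos (by positivity), hqr] at h1
      have h2 : c / 2 ≤ L / (L + t) := by
        rw [div_le_div_iff₀ (by norm_num) hd0]
        nlinarith [hqR.2]
      have h3 : t / (L + t) ≤ 1 := by
        rw [div_le_one hd0]
        linarith
      have h4 : c / 2 * r ≤ L / (L + t) * r := by gcongr
      have h5 : t / (L + t) * ‖shadow b 0 1 m‖ ≤ ‖shadow b 0 1 m‖ :=
        mul_le_of_le_one_left (norm_nonneg _) h3
      linarith [mul_nonneg hc0.le hr]

/-- A body that is deep on both sides of the origin in the direction `b 2` has normals almost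
orthogonal to `b 2` over its middle part, so that its cone-volume measure charges a narrow
band. -/
theorem length_le_of_deep {lam : ℝ} (hlam : 0 < lam) {K : ConvexBody E3}
    {hK : (interior (K : Set E3)).Nonempty} (hc : IsComparable lam K hK) (h0 : (0 : E3) ∈ K)
    (b : OrthonormalBasis (Fin 3) ℝ E3) {R r c g : ℝ} (hR : 0 < R) (hc0 : 0 < c) (hc1 : c ≤ 1)
    (hr : 0 < r) (hrR : r ≤ R) (hp : R • b 2 ∈ K) (hxR : ∀ x ∈ K, ‖x‖ ≤ R)
    (hxr : ∀ x ∈ K, ‖shadow b 0 1 x‖ ≤ r) {m : E3} (hm : m ∈ K) (hmL : ⟪b 2, m⟫ ≤ -(c * R))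
    (hg : g • b 0 ∈ K) (hgr : c * r / 8 ≤ g) :
    R ≤ 3185049600 * lam ^ 2 / c ^ 4 * r := by
  have h : Distinct 0 1 2 := ⟨by decide, by decide, by decide⟩
  have h120 : Distinct 1 2 0 := h.rotate
  have ho : ∀ p q : Fin 3, ⟪b p, b q⟫ = if p = q then (1 : ℝ) else 0 :=
    orthonormal_iff_ite.1 b.orthonormal
  obtain ⟨a, ha, hmax⟩ := K.isCompact.exists_isMaxOn K.nonempty (f := fun x => |⟪b 1, x⟫|)
    (by fun_prop)
  set w := |⟪b 1, a⟫| with hw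
  have hxw : ∀ x ∈ K, |⟪b 1, x⟫| ≤ w := fun x hx => hmax hx
  have hA : shadowArea K b 0 1 ≤ 4 * r * w := by
    refine shadowArea_le K b 0 1 hr.le (abs_nonneg _) (fun x hx => ?_) hxw
    have := (abs_coord_le_norm_E2 (shadow b 0 1 x)).1
    rw [shadow_zero_coord] at this
    exact this.trans (hxr x hx)
  have h1 : 1 ≤ 72 * lam * R * r * w := by
    have h2 := one_le_depth_mul_shadowArea hlam hc b h hR.le
      (fun x hx => (abs_le.1 ((abs_coord_le_norm b 2 x).trans (hxR x hx))).1) hxr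
    calc 1 ≤ _ := h2
      _ ≤ 9 * lam * (R + R) * (4 * r * w) := by
        have := shadowArea_nonneg K b 0 1
        gcongr
      _ = _ := by ring
  -- the parallelogram spanned by the projections of `(c / 2) • R • b 2` and `(c / 2) • a`
  set D : Set E2 := planeMap 0 (c / 2 * ⟪b 1, a⟫) (c / 2 * R) (c / 2 * ⟪b 2, a⟫) ''
    rect (Icc 0 (1 / 2)) (Icc 0 (1 / 2)) with hD
  have hDK : D ⊆ shadow b 1 2 '' K := by
    rintro _ ⟨y, ⟨⟨h3, h4⟩, h5, h6⟩, rfl⟩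
    refine ⟨(y 0 * (c / 2)) • R • b 2 + (y 1 * (c / 2)) • a, comb_mem_of_zero_mem h0 hp ha
      (by positivity) (by positivity) (by nlinarith), ?_⟩
    rw [planeMap_apply]
    ext l
    fin_cases l <;> simp [inner_add_right, real_inner_smul_right, ho] <;> ring
  have hD2 : ∀ d ∈ D, |d 1| ≤ c * R / 2 := by
    rintro _ ⟨y, ⟨⟨h3, h4⟩, h5, h6⟩, rfl⟩
    rw [planeMap_apply]
    simp only [Matrix.cons_val_one, Matrix.cons_val_fin_one]
    have ha2 := (abs_coord_le_norm b 2 a).trans (hxR a ha)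
    have h7 : |c / 2 * R * y 0| ≤ c / 2 * R * (1 / 2) := by
      rw [abs_of_nonneg (by positivity)]
      gcongr
    have h8 : |c / 2 * ⟪b 2, a⟫ * y 1| ≤ c / 2 * R * (1 / 2) := by
      rw [abs_mul, abs_mul, abs_of_nonneg (by positivity : 0 ≤ c / 2), abs_of_nonneg h5]
      gcongr
    exact (abs_add_le _ _).trans (by linarith)
  have hDa : ENNReal.ofReal (c ^ 2 * R * w / 16) ≤ μHE[2] D := by
    rw [hD, area_parallelogram]
    refine le_of_eq ?_
    congr 1
    rw [zero_mul, zero_sub, abs_neg, abs_mul, abs_mul, abs_of_pos (by positivity : 0 < c / 2 * R),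
      abs_of_pos (by positivity : 0 < c / 2)]
    ring
  have hnorm : ∀ x ∈ K, shadow b 1 2 x ∈ D → ∀ u ∈ normalMap K x,
      |⟪b 2, (u : E3)⟫| ≤ 4 * r / (c * R) := by
    intro x hx hxD u hu
    have hx2 := hD2 _ hxD
    rw [shadow_one_coord] at hx2
    have hx2' := abs_le.1 hx2
    -- every point of `K` bounds the normal, because the projections are at distance at most `2 r`
    have key : ∀ y ∈ K, ⟪b 2, (u : E3)⟫ * (⟪b 2, y⟫ - ⟪b 2, x⟫) ≤ 2 * r := by
      intro y hy
      have h3 := hu y hy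
      have h4 := abs_le.1 (inner_le_of_shadow b h u x)
      have h5 := abs_le.1 (inner_le_of_shadow b h u y)
      have h6 := hxr x hx
      have h7 := hxr y hy
      linarith [h4.1, h4.2, h5.1, h5.2]
    have hcR : 0 < c * R := by positivity
    have hcRR : c * R ≤ R := mul_le_of_le_one_left hR.le hc1
    rw [le_div_iff₀ hcR]
    rcases le_total 0 ⟪b 2, (u : E3)⟫ with hu0 | hu0
    · rw [abs_of_nonneg hu0]
      have h3 := key _ hp
      simp only [real_inner_smul_right, ho, if_true, mul_one] at h3
      have h4 : ⟪b 2, (u : E3)⟫ * (c * R / 2) ≤ ⟪b 2, (u : E3)⟫ * (R - ⟪b 2, x⟫) := by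
        gcongr
        linarith
      linarith
    · rw [abs_of_nonpos hu0]
      have h3 := key _ hm
      have h4 : -⟪b 2, (u : E3)⟫ * (c * R / 2) ≤ -⟪b 2, (u : E3)⟫ * (⟪b 2, x⟫ - ⟪b 2, m⟫) := by
        gcongr
        · linarith
        · linarith
      linarith
  have hfin := chord_mul_area_le_of_band hlam hc b h120 h hg hDK
    (by positivity : 0 ≤ 4 * r / (c * R)) hnorm hDa
  have hw0 : 0 ≤ w := abs_nonneg _
  have hg0 : 0 ≤ g := le_trans (by positivity) hgr
  rw [abs_of_nonneg hg0] at hfin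
  have h3 : c * r / 8 * (c ^ 2 * R * w / 16) ≤ 86400 * lam * (4 * r / (c * R)) :=
    le_trans (by gcongr) hfin
  have h4 : c ^ 3 * (R * r * w) * (c * R) ≤ 44236800 * lam * r := by
    have h5 : 86400 * lam * (4 * r / (c * R)) * (c * R) = 345600 * lam * r := by
      field_simp
      ring
    nlinarith [mul_le_mul_of_nonneg_right h3 (by positivity : 0 ≤ c * R)]
  have h6 : c ^ 4 * R ≤ 3185049600 * lam ^ 2 * r := by
    calc c ^ 4 * R = c ^ 4 * R * 1 := by ring
      _ ≤ c ^ 4 * R * (72 * lam * R * r * w) := by gcongr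
      _ = 72 * lam * (c ^ 3 * (R * r * w) * (c * R)) := by ring
      _ ≤ 72 * lam * (44236800 * lam * r) := by gcongr
      _ = _ := by ring
  rw [div_mul_eq_mul_div, le_div_iff₀ (by positivity)]
  linarith

/-- The body is not needle-shaped: its length is controlled by its second largest extent. -/
theorem exists_length_le_width {lam : ℝ} (hlam : 0 < lam) : ∃ M : ℝ, 0 < M ∧
    ∀ (K : ConvexBody E3) (hK : (interior (K : Set E3)).Nonempty), IsComparable lam K hK →
      (0 : E3) ∈ K → ∀ (b : OrthonormalBasis (Fin 3) ℝ E3) (R r : ℝ), 0 < R → R • b 2 ∈ K →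
      (∀ x ∈ K, ‖x‖ ≤ R) → (∀ x ∈ K, ‖shadow b 0 1 x‖ ≤ r) → ∀ q ∈ K, ‖shadow b 0 1 q‖ = r →
      R ≤ M * r := by
  -- `c` is such that `2 * c * R ≤ L + r` for the depth `L` below the origin
  obtain ⟨c, hcdef⟩ : ∃ c : ℝ, c = 1 / (777600 * lam ^ 2) := ⟨_, rfl⟩
  have hc0 : 0 < c := by rw [hcdef]; positivity
  refine ⟨1 / c + 3185049600 * lam ^ 2 / c ^ 4, by positivity, ?_⟩
  intro K hK hc h0 b R r hR hp hxR hxr q hq hqr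
  have h : Distinct 0 1 2 := ⟨by decide, by decide, by decide⟩
  have hr0 : 0 ≤ r := hqr ▸ norm_nonneg _
  have hle : ∀ {α β : ℝ}, 0 ≤ α → 0 ≤ β → R ≤ α * r ∨ R ≤ β * r → R ≤ (α + β) * r := by
    intro α β hα hβ hor
    rw [add_mul]
    have := mul_nonneg hα hr0
    have := mul_nonneg hβ hr0
    rcases hor with h | h <;> linarith
  refine hle (by positivity) (by positivity) ?_
  have hrR : r ≤ R := by
    rw [← hqr]
    refine le_trans (le_of_sq_le_sq ?_ (norm_nonneg _)) (hxR q hq)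
    rw [norm_shadow_sq b h]
    nlinarith [sq_nonneg ⟪b 2, q⟫]
  obtain ⟨m, hm, hmin⟩ := K.isCompact.exists_isMinOn K.nonempty (f := fun x => ⟪b 2, x⟫)
    (by fun_prop)
  obtain ⟨L, hmL⟩ : ∃ L : ℝ, ⟪b 2, m⟫ = -L := ⟨-⟪b 2, m⟫, by ring⟩
  have hL0 : 0 ≤ L := by
    have : ⟪b 2, m⟫ ≤ ⟪b 2, (0 : E3)⟫ := hmin h0
    rw [inner_zero_right] at this
    linarith
  have hxL : ∀ x ∈ K, -L ≤ ⟪b 2, x⟫ := fun x hx => hmL ▸ hmin hx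
  have hLR : L ≤ R := by
    have := (abs_le.1 ((abs_coord_le_norm b 2 m).trans (hxR m hm))).1
    linarith
  have h1 := one_le_depth_mul_shadowArea hlam hc b h hL0 hxL hxr
  have h2 := chord_mul_shadowArea_le hlam hc b h hp
  rw [abs_of_pos hR] at h2
  have hrpos : 0 < r := by
    refine lt_of_le_of_ne hr0 fun hr => ?_
    have : shadowArea K b 0 1 ≤ 4 * r * r := by
      refine shadowArea_le K b 0 1 hr0 hr0 (fun x hx => ?_) (fun x hx => ?_)
      · simpa using (abs_coord_le_norm_E2 (shadow b 0 1 x)).1.trans (hxr x hx)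
      · simpa using (abs_coord_le_norm_E2 (shadow b 0 1 x)).2.trans (hxr x hx)
    have h3 : shadowArea K b 0 1 = 0 :=
      le_antisymm (by rw [← hr] at this; simpa using this) (shadowArea_nonneg K b 0 1)
    rw [h3, mul_zero] at h1
    linarith
  have h3 : 2 * (c * R) ≤ L + r := by
    have h4 : R ≤ 388800 * lam ^ 2 * (L + r) := by
      calc R = R * 1 := by ring
        _ ≤ R * (9 * lam * (L + r) * shadowArea K b 0 1) := by gcongr
        _ = 9 * lam * (L + r) * (R * shadowArea K b 0 1) := by ring
        _ ≤ 9 * lam * (L + r) * (43200 * lam) := by gcongr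
        _ = _ := by ring
    rw [hcdef, div_mul_eq_mul_div, one_mul, mul_div_assoc', div_le_iff₀ (by positivity)]
    linarith
  rcases le_or_gt (c * R) r with hcr | hcr
  · left
    rw [div_mul_eq_mul_div, one_mul, le_div_iff₀ hc0]
    linarith
  right
  have hcL : c * R ≤ L := by linarith
  have hc1 : c ≤ 1 := by
    by_contra! hlt
    nlinarith
  obtain ⟨z, hz, hz0, hzr⟩ := exists_section_point b hR hc0 hc1 hr0 hp hxR hq hm hqr hmL hcL
  have hzpos : 0 < ‖z‖ := lt_of_lt_of_le (by positivity) hzr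
  obtain ⟨b', hb0, hb2⟩ := exists_frame (i := 0) (j := 2) (by decide) (u := ‖z‖⁻¹ • z) (v := b 2)
    (by simp [norm_smul, hzpos.ne']) (by simp)
    (by rw [real_inner_smul_left, real_inner_comm, hz0, mul_zero])
  refine length_le_of_deep hlam hc h0 b' (g := ‖z‖) hR hc0 hc1 hrpos hrR (hb2 ▸ hp) hxR
    (fun x hx => ?_) hm ?_ ?_ hzr
  · refine le_trans (le_of_sq_le_sq ?_ (norm_nonneg _)) (hxr x hx)
    rw [norm_shadow_sq b h, norm_shadow_sq b' h, hb2]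
  · rw [hb2, hmL]
    linarith
  · rw [hb0, smul_smul, mul_inv_cancel₀ hzpos.ne', one_smul]
    exact hz

/-! ### Plates -/

/-- A thin plate `K` reaches far from the origin in every direction `b 1` of the plate. Otherwise
`h_K` is at most of order `R t` on the normals at distance `t` from `b 1` in the plane of the
plate, so that the surface area of every dyadic shell of such normals is at least `1 / (6 λ R)`,
while the rim of the plate has area at most `36 w R`. -/
theorem number_of_shells_le {lam : ℝ} (hlam : 0 < lam) {K : ConvexBody E3}
    {hK : (interior (K : Set E3)).Nonempty} (hc : IsComparable lam K hK)
    (b : OrthonormalBasis (Fin 3) ℝ E3) {R w : ℝ} (hR : 0 < R) (hxR : ∀ x ∈ K, ‖x‖ ≤ R)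
    (hw : 0 ≤ w) (hxw : ∀ x ∈ K, |⟪b 0, x⟫| ≤ w) {N : ℕ} (hwN : w ≤ (1 / 2) ^ N * R)
    (hN : ∀ x ∈ K, ⟪b 1, x⟫ ≤ (1 / 2) ^ N * R) : N ≤ 216 * lam * w * R ^ 2 := by
  have h021 : Distinct 0 2 1 := ⟨by decide, by decide, by decide⟩
  let J : ℕ → Set ℝ := fun n => Ioc ((1 / 2) ^ (n + 2)) ((1 / 2) ^ (n + 1))
  let E : ℕ → Set S2 := fun n =>
    cap b 1 1 ∩ {u | ⟪b 0, (u : E3)⟫ ∈ Icc (-(1 / 2)) (1 / 2) ∧ ⟪b 2, (u : E3)⟫ ∈ J n}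
  have hE : ∀ n, MeasurableSet (E n) := by
    intro n
    have c0 : Continuous fun u : S2 => ⟪b 0, (u : E3)⟫ := by fun_prop
    have c2 : Continuous fun u : S2 => ⟪b 2, (u : E3)⟫ := by fun_prop
    exact (isClosed_cap b 1 1).measurableSet.inter
      ((c0.measurable measurableSet_Icc).inter (c2.measurable measurableSet_Ioc))
  have hdisj : Pairwise (Function.onFun Disjoint E) := by
    have hanti : Antitone fun n : ℕ => (1 / 2 : ℝ) ^ (n + 1) := fun m n hmn =>
      pow_le_pow_of_le_one (by norm_num) (by norm_num) (by omega)
    intro m n hmn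
    have := (hanti.pairwise_disjoint_on_Ioc_succ hmn).preimage fun u : S2 => ⟪b 2, (u : E3)⟫
    exact this.mono (fun u hu => hu.2.2) (fun u hu => hu.2.2)
  have hshell : ∀ n < N, ENNReal.ofReal (1 / (6 * lam * R)) ≤ surfaceAreaMeasure K hK (E n) := by
    intro n hn
    set t : ℝ := (1 / 2) ^ (n + 1) with ht
    have ht0 : 0 < t := by positivity
    have htN : (1 / 2 : ℝ) ^ N ≤ t := pow_le_pow_of_le_one (by norm_num) (by norm_num) (by omega)
    have ht2 : (1 / 2 : ℝ) ^ (n + 2) = t / 2 := by rw [ht]; ring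
    have ht1 : t ≤ 1 / 2 := by
      rw [ht, pow_succ]
      have : (1 / 2 : ℝ) ^ n ≤ 1 := pow_le_one₀ (by norm_num) (by norm_num)
      linarith
    have hsig : ENNReal.ofReal (t / 2) ≤ sphereArea (E n) := by
      have hJ : J n ⊆ Icc (-(1 / 2)) (1 / 2) := fun y hy =>
        ⟨by have : (1 / 2 : ℝ) ^ (n + 2) < y := hy.1
            rw [ht2] at this
            linarith, le_trans hy.2 ht1⟩
      refine le_trans (le_of_eq ?_) (area_rect_le_sphereArea b h021 (s := 1) (by norm_num)
        (Subset.refl (Icc (-(1 / 2)) (1 / 2))) hJ)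
      rw [Real.volume_Icc, Real.volume_Ioc, ← ENNReal.ofReal_mul (by norm_num), ht2, ← ht]
      congr 1
      ring
    have hsup : ∀ u ∈ E n, supportFunction K u ≤ 3 * t * R := by
      rintro u ⟨hu1, -, hu2⟩
      refine supportFunction_le K u fun x hx => ?_
      rw [inner_frame b h021]
      have h1 : 1 / 2 ≤ 1 * ⟪b 1, (u : E3)⟫ := hu1
      have h2 : (1 / 2 : ℝ) ^ (n + 2) < ⟪b 2, (u : E3)⟫ := hu2.1
      have h3 : ⟪b 2, (u : E3)⟫ ≤ t := hu2.2
      have h4 := (abs_le.1 (abs_coord_le_one b 1 u)).2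
      have h5 := abs_coord_le_one b 0 u
      have h6 := (abs_le.1 ((abs_coord_le_norm b 2 x).trans (hxR x hx))).2
      rw [ht2] at h2
      have e0 : ⟪b 0, (u : E3)⟫ * ⟪b 0, x⟫ ≤ t * R := by
        calc ⟪b 0, (u : E3)⟫ * ⟪b 0, x⟫ ≤ |⟪b 0, (u : E3)⟫| * |⟪b 0, x⟫| := by
              rw [← abs_mul]; exact le_abs_self _
          _ ≤ 1 * w := by gcongr; exact hxw x hx
          _ ≤ (1 / 2) ^ N * R := by linarith
          _ ≤ t * R := by gcongr
      have e1 : ⟪b 1, (u : E3)⟫ * ⟪b 1, x⟫ ≤ t * R := by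
        calc ⟪b 1, (u : E3)⟫ * ⟪b 1, x⟫ ≤ ⟪b 1, (u : E3)⟫ * ((1 / 2) ^ N * R) := by
              gcongr
              · linarith
              · exact hN x hx
          _ ≤ 1 * (t * R) := by gcongr
          _ = t * R := one_mul _
      have e2 : ⟪b 2, (u : E3)⟫ * ⟪b 2, x⟫ ≤ t * R := by
        calc ⟪b 2, (u : E3)⟫ * ⟪b 2, x⟫ ≤ ⟪b 2, (u : E3)⟫ * R := by
              gcongr
              linarith
          _ ≤ t * R := by gcongr
      linarith
    have hle := hsig.trans (sphereArea_le_surfaceArea hlam hc (hE n) hsup)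
    calc ENNReal.ofReal (1 / (6 * lam * R))
        = ENNReal.ofReal (1 / (lam * (3 * t * R))) * ENNReal.ofReal (t / 2) := by
          rw [← ENNReal.ofReal_mul (by positivity)]
          congr 1
          field_simp
          norm_num
      _ ≤ ENNReal.ofReal (1 / (lam * (3 * t * R))) *
          (ENNReal.ofReal (lam * (3 * t * R)) * surfaceAreaMeasure K hK (E n)) := by gcongr
      _ = surfaceAreaMeasure K hK (E n) := by
          rw [← mul_assoc, ← ENNReal.ofReal_mul (by positivity),
            one_div_mul_cancel (by positivity), ENNReal.ofReal_one, one_mul]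
  have hsum : (N : ℝ≥0∞) * ENNReal.ofReal (1 / (6 * lam * R)) ≤
      9 * ENNReal.ofReal (4 * w * R) := by
    calc (N : ℝ≥0∞) * ENNReal.ofReal (1 / (6 * lam * R))
        = ∑ _n ∈ Finset.range N, ENNReal.ofReal (1 / (6 * lam * R)) := by simp
      _ ≤ ∑ n ∈ Finset.range N, surfaceAreaMeasure K hK (E n) :=
          Finset.sum_le_sum fun n hn => hshell n (Finset.mem_range.1 hn)
      _ = surfaceAreaMeasure K hK (⋃ n ∈ Finset.range N, E n) :=
          (measure_biUnion_finset (fun m _ n _ hmn => hdisj hmn) fun n _ => hE n).symm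
      _ ≤ 9 * μHE[2] (shadow b 0 2 '' K) :=
          surfaceArea_cap_le K hK b h021 (s := 1) (by norm_num)
            (iUnion₂_subset fun n _ => inter_subset_left)
      _ ≤ 9 * ENNReal.ofReal (4 * w * R) := by
          rw [← ofReal_shadowArea]
          gcongr
          exact shadowArea_le K b 0 2 hw hR.le hxw
            fun x hx => (abs_coord_le_norm b 2 x).trans (hxR x hx)
  rw [← ENNReal.ofReal_natCast, ← ENNReal.ofReal_mul (by positivity),
    show (9 : ℝ≥0∞) = ENNReal.ofReal 9 by norm_num, ← ENNReal.ofReal_mul (by norm_num),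
    ENNReal.ofReal_le_ofReal_iff (by positivity), mul_one_div, div_le_iff₀ (by positivity)] at hsum
  linarith

/-- If `K` reaches farther than `ρ` in every direction orthogonal to `b 0`, then its projection
along `b 0` contains the disk of radius `ρ`. -/
theorem exists_shadow_eq {K : ConvexBody E3} (b : OrthonormalBasis (Fin 3) ℝ E3) {ρ : ℝ}
    (hdeep : ∀ v : E3, ‖v‖ = 1 → ⟪b 0, v⟫ = 0 → ∃ x ∈ K, ρ < ⟪v, x⟫) {y : E2} (hy : ‖y‖ ≤ ρ) :
    ∃ z ∈ K, shadow b 1 2 z = y := by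
  have h120 : Distinct 1 2 0 := ⟨by decide, by decide, by decide⟩
  have ho : ∀ p q : Fin 3, ⟪b p, b q⟫ = if p = q then (1 : ℝ) else 0 :=
    orthonormal_iff_ite.1 b.orthonormal
  by_contra hn
  have hconv : Convex ℝ (shadow b 1 2 '' K) := by
    rintro _ ⟨x, hx, rfl⟩ _ ⟨x', hx', rfl⟩ α β hα hβ hαβ
    exact ⟨α • x + β • x', comb_mem hx hx' hα hβ hαβ, shadow_comb b 1 2 x x' α β⟩
  have hclosed : IsClosed (shadow b 1 2 '' K) :=
    (K.isCompact.image (continuous_shadow b 1 2)).isClosed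
  obtain ⟨f, c, hfc, hcy⟩ := geometric_hahn_banach_closed_point hconv hclosed hn
  let n : E2 := (InnerProductSpace.toDual ℝ E2).symm f
  have hnf : ∀ a, ⟪n, a⟫ = f a := fun a => InnerProductSpace.toDual_symm_apply
  have hn0 : 0 < ‖n‖ := by
    rw [norm_pos_iff]
    intro h0
    obtain ⟨x, hx⟩ := K.nonempty
    have h1 := (hfc _ ⟨x, hx, rfl⟩).trans hcy
    rw [← hnf, ← hnf, h0, inner_zero_left, inner_zero_left] at h1
    exact lt_irrefl _ h1
  set v : E3 := (n 0 / ‖n‖) • b 1 + (n 1 / ‖n‖) • b 2 with hv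
  have hvx : ∀ x, ⟪v, x⟫ = ⟪n, shadow b 1 2 x⟫ / ‖n‖ := by
    intro x
    have : ⟪n, shadow b 1 2 x⟫ = n 0 * ⟪b 1, x⟫ + n 1 * ⟪b 2, x⟫ := by
      rw [PiLp.inner_apply, Fin.sum_univ_two]
      simp [mul_comm]
    rw [this, hv, inner_add_left, real_inner_smul_left, real_inner_smul_left]
    ring
  obtain ⟨x, hx, hxv⟩ := hdeep v (by
    have h1 := norm_sq_frame b h120 v
    simp only [hv, inner_add_right, real_inner_smul_right, ho] at h1
    simp only [if_true, Fin.isValue, show ((1 : Fin 3) = 2) = False by decide,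
      show ((2 : Fin 3) = 1) = False by decide, show ((0 : Fin 3) = 1) = False by decide,
      show ((0 : Fin 3) = 2) = False by decide, if_false, mul_one, mul_zero, add_zero,
      zero_add] at h1
    rw [← hv] at h1
    have h2 := norm_sq_E2 n
    rw [← sq_eq_sq₀ (norm_nonneg _) zero_le_one, h1]
    field_simp
    linarith) (by
    simp [hv, inner_add_right, real_inner_smul_right, ho])
  rw [hvx, lt_div_iff₀ hn0] at hxv
  have h1 := (hfc _ ⟨x, hx, rfl⟩).trans hcy
  rw [← hnf, ← hnf] at h1
  have h2 := real_inner_le_norm n y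
  have h3 : ‖n‖ * ‖y‖ ≤ ‖n‖ * ρ := by gcongr
  linarith

/-- A plate whose projection along `b 0` contains a disk around the origin has a long chord
through the origin in the direction `b 0`. The tetrahedron spanned by the origin, `p`, `q` and `a`
has such a chord somewhere, and a homothety moves it to the origin. -/
theorem exists_chord {K : ConvexBody E3} (h0 : (0 : E3) ∈ K)
    (b : OrthonormalBasis (Fin 3) ℝ E3) {R r d w : ℝ} (hr : 0 < r) (hrR : r ≤ R)
    (hd : 0 < d) (hd1 : d ≤ 1) (hp : R • b 2 ∈ K) (hxR : ∀ x ∈ K, ‖x‖ ≤ R) {q a : E3}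
    (hq : q ∈ K) (hq0 : ⟪b 0, q⟫ = 0) (hq1 : ⟪b 1, q⟫ = r) (ha : a ∈ K) (haw : |⟪b 0, a⟫| = w)
    (hdisk : ∀ y : E2, ‖y‖ ≤ d * R → ∃ z ∈ K, shadow b 1 2 z = y) :
    ∃ g : ℝ, g • b 0 ∈ K ∧ d * r * w / (96 * R) ≤ |g| := by
  have h120 : Distinct 1 2 0 := ⟨by decide, by decide, by decide⟩
  have ho : ∀ p q : Fin 3, ⟪b p, b q⟫ = if p = q then (1 : ℝ) else 0 :=
    orthonormal_iff_ite.1 b.orthonormal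
  have hR : 0 < R := hr.trans_le hrR
  set μ : ℝ := r / (24 * R) with hμ
  have hμ0 : 0 < μ := by positivity
  have hμ1 : μ ≤ 1 / 24 := by
    rw [hμ, div_le_div_iff₀ (by positivity) (by norm_num)]
    linarith
  have ha1 := (abs_coord_le_norm b 1 a).trans (hxR a ha)
  have ha2 := (abs_coord_le_norm b 2 a).trans (hxR a ha)
  have hq2 := (abs_coord_le_norm b 2 q).trans (hxR q hq)
  -- `(ν + α', ν + β')` are the coordinates of the projection of `x` below with respect to
  -- `R • b 2` and `q`; `α'` and `β'` correct for the admixture of `a`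
  set β' : ℝ := μ * ⟪b 1, a⟫ / r with hβ'
  have hβ1 : |β'| ≤ 1 / 24 := by
    rw [hβ', abs_div, abs_mul, abs_of_pos hμ0, abs_of_pos hr, div_le_iff₀ hr]
    calc μ * |⟪b 1, a⟫| ≤ μ * R := by gcongr
      _ = 1 / 24 * r := by rw [hμ]; field_simp
  set α' : ℝ := μ * ⟪b 2, a⟫ / R - β' * ⟪b 2, q⟫ / R with hα'
  have hα1 : |α'| ≤ 1 / 12 := by
    have e1 : |μ * ⟪b 2, a⟫ / R| ≤ 1 / 24 := by
      rw [abs_div, abs_mul, abs_of_pos hμ0, abs_of_pos hR, div_le_iff₀ hR]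
      gcongr
    have e2 : |β' * ⟪b 2, q⟫ / R| ≤ 1 / 24 := by
      rw [abs_div, abs_mul, abs_of_pos hR, div_le_iff₀ hR]
      gcongr
    exact (abs_sub _ _).trans (by linarith)
  have hα2 := abs_le.1 hα1
  have hβ2 := abs_le.1 hβ1
  -- `x` and `x'` are two points of `K` on a line in the direction `b 0`
  set ν : ℝ := (1 - μ) / 3 with hν
  have hxmem : (1 - μ) • ((1 / 3 : ℝ) • R • b 2 + (1 / 3 : ℝ) • q) + μ • a ∈ K :=
    comb_mem (comb_mem_of_zero_mem h0 hp hq (by norm_num) (by norm_num) (by norm_num)) ha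
      (by linarith) hμ0.le (by ring)
  have hxmem' : (ν + α') • R • b 2 + (ν + β') • q ∈ K :=
    comb_mem_of_zero_mem h0 hp hq (by linarith [hα2.1]) (by linarith [hβ2.1])
      (by linarith [hα2.2, hβ2.2])
  set x := (1 - μ) • ((1 / 3 : ℝ) • R • b 2 + (1 / 3 : ℝ) • q) + μ • a with hx
  set x' := (ν + α') • R • b 2 + (ν + β') • q with hx'
  have hsh : shadow b 1 2 x = shadow b 1 2 x' := by
    ext l
    fin_cases l
    · simp [hx, hx', inner_add_right, real_inner_smul_right, ho, hq1, hν, hβ']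
      field_simp
    · simp [hx, hx', inner_add_right, real_inner_smul_right, hν, hα']
      field_simp
      ring
  have hx0 : ⟪b 0, x⟫ = μ * ⟪b 0, a⟫ := by
    simp [hx, inner_add_right, real_inner_smul_right, ho, hq0]
  have hx0' : ⟪b 0, x'⟫ = 0 := by
    simp [hx', inner_add_right, real_inner_smul_right, ho, hq0]
  have hshR : ‖shadow b 1 2 x‖ ≤ R := by
    refine le_trans (le_of_sq_le_sq ?_ (norm_nonneg _)) (hxR x hxmem)
    rw [norm_shadow_sq b h120]
    nlinarith [sq_nonneg ⟪b 0, x⟫]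
  obtain ⟨z, hz, hzx⟩ := hdisk (-d • shadow b 1 2 x) (by
    rw [norm_smul, norm_neg, Real.norm_eq_abs, abs_of_pos hd]
    gcongr)
  have haxis : ∀ y ∈ K, shadow b 1 2 y = shadow b 1 2 x →
      ((d * ⟪b 0, y⟫ + ⟪b 0, z⟫) / (1 + d)) • b 0 ∈ K := by
    intro y hy hyx
    have hmem : (d / (1 + d)) • y + (1 / (1 + d)) • z ∈ K :=
      comb_mem hy hz (by positivity) (by positivity) (by field_simp; ring)
    have hs0 : shadow b 1 2 ((d / (1 + d)) • y + (1 / (1 + d)) • z) = 0 := by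
      rw [shadow_comb, hyx, hzx, smul_smul, ← add_smul]
      have : d / (1 + d) + 1 / (1 + d) * -d = 0 := by field_simp; ring
      rw [this, zero_smul]
    convert hmem using 1
    rw [← b.sum_repr' ((d / (1 + d)) • y + (1 / (1 + d)) • z), Fin.sum_univ_three]
    have e1 := congrArg (fun y : E2 => y 0) hs0
    have e2 := congrArg (fun y : E2 => y 1) hs0
    simp only [shadow_zero_coord, shadow_one_coord, PiLp.zero_apply] at e1 e2
    rw [e1, e2, zero_smul, zero_smul, add_zero, add_zero, inner_add_right, real_inner_smul_right,
      real_inner_smul_right]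
    congr 1
    ring
  have hg1 := haxis x hxmem rfl
  have hg2 := haxis x' hxmem' hsh.symm
  rw [hx0] at hg1
  rw [hx0', mul_zero, zero_add] at hg2
  set g1 := (d * (μ * ⟪b 0, a⟫) + ⟪b 0, z⟫) / (1 + d) with hg1d
  set g2 := ⟪b 0, z⟫ / (1 + d) with hg2d
  have hdiff : d * r * w / (48 * R) ≤ |g1 - g2| := by
    have : g1 - g2 = d * μ / (1 + d) * ⟪b 0, a⟫ := by
      rw [hg1d, hg2d]
      ring
    rw [this, abs_mul, haw, abs_of_pos (by positivity)]
    have hw0 : 0 ≤ w := haw ▸ abs_nonneg _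
    calc d * r * w / (48 * R) = d * μ / 2 * w := by rw [hμ]; field_simp; ring
      _ ≤ d * μ / (1 + d) * w := by
        gcongr
        linarith
  have htri := abs_sub g1 g2
  have hhalf : d * r * w / (96 * R) = d * r * w / (48 * R) / 2 := by
    field_simp
    ring
  rcases le_total |g1| |g2| with hle | hle
  · exact ⟨g2, hg2, by rw [hhalf]; linarith⟩
  · exact ⟨g1, hg1, by rw [hhalf]; linarith⟩

/-- The normals of a thin plate over the middle part of a disk in its projection are nearly
orthogonal to the plate, so that the cone-volume measure charges a narrow band. -/
theorem length_le_of_disk {lam : ℝ} (hlam : 0 < lam) {K : ConvexBody E3}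
    {hK : (interior (K : Set E3)).Nonempty} (hc : IsComparable lam K hK)
    (b : OrthonormalBasis (Fin 3) ℝ E3) {R d w g κ : ℝ} (hR : 0 < R) (hd : 0 < d) (hw : 0 < w)
    (hκ : 0 < κ) (hxw : ∀ x ∈ K, |⟪b 0, x⟫| ≤ w)
    (hdisk : ∀ y : E2, ‖y‖ ≤ d * R → ∃ z ∈ K, shadow b 1 2 z = y)
    (hg : g • b 0 ∈ K) (hgw : κ * w ≤ |g|) : R ^ 3 ≤ 1382400 * lam / (κ * d ^ 3) := by
  have h120 : Distinct 1 2 0 := ⟨by decide, by decide, by decide⟩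
  set ρ : ℝ := d * R / 4 with hρ
  have hρ0 : 0 < ρ := by positivity
  have hDK : rect (Icc (-ρ) ρ) (Icc (-ρ) ρ) ⊆ shadow b 1 2 '' K := by
    rintro y ⟨hy0, hy1⟩
    obtain ⟨z, hz, hzy⟩ := hdisk y (by
      refine le_of_sq_le_sq ?_ (by positivity)
      rw [norm_sq_E2]
      have := sq_le_sq' hy0.1 hy0.2
      have := sq_le_sq' hy1.1 hy1.2
      have : d * R = 4 * ρ := by rw [hρ]; ring
      rw [this]
      nlinarith)
    exact ⟨z, hz, hzy⟩
  have hfin := chord_mul_area_le_of_band hlam hc b h120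
    (⟨by decide, by decide, by decide⟩ : Distinct 0 2 1) hg hDK
    (by positivity : 0 ≤ 4 * w / (d * R)) (by
      intro x hx hxD u hu
      obtain ⟨hx1, hx2⟩ := hxD
      rw [shadow_zero_coord] at hx1
      rw [shadow_one_coord] at hx2
      obtain ⟨s, hs1, hs2⟩ : ∃ s : ℝ, |s| = 1 ∧ s * ⟪b 1, (u : E3)⟫ = |⟪b 1, (u : E3)⟫| := by
        rcases le_total 0 ⟪b 1, (u : E3)⟫ with h | h
        · exact ⟨1, by simp, by rw [abs_of_nonneg h, one_mul]⟩
        · exact ⟨-1, by simp, by rw [abs_of_nonpos h]; ring⟩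
      -- a point of `K` over the translate of the projection of `x` in the direction `± b 1`
      obtain ⟨z, hz, hzy⟩ := hdisk (!₂[⟪b 1, x⟫ + s * (2 * ρ), ⟪b 2, x⟫]) (by
        refine le_of_sq_le_sq ?_ (by positivity)
        rw [norm_sq_E2]
        simp only [Matrix.cons_val_zero, Matrix.cons_val_one, Matrix.cons_val_fin_one]
        have e1 : |⟪b 1, x⟫ + s * (2 * ρ)| ≤ 3 * ρ := by
          refine (abs_add_le _ _).trans ?_
          rw [abs_mul, hs1, one_mul, abs_of_pos (by positivity : 0 < 2 * ρ)]
          linarith [abs_le.2 hx1]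
        have e2 := sq_le_sq' (abs_le.1 e1).1 (abs_le.1 e1).2
        have e3 := sq_le_sq' hx2.1 hx2.2
        have : d * R = 4 * ρ := by rw [hρ]; ring
        rw [this]
        nlinarith)
      have z1 := congrArg (fun y : E2 => y 0) hzy
      have z2 := congrArg (fun y : E2 => y 1) hzy
      simp only [shadow_zero_coord, shadow_one_coord, Matrix.cons_val_zero, Matrix.cons_val_one,
        Matrix.cons_val_fin_one] at z1 z2
      have h1 := hu z hz
      rw [inner_frame b h120, inner_frame b h120 _ x, z1, z2] at h1
      have h2 : |⟪b 0, (u : E3)⟫ * (⟪b 0, x⟫ - ⟪b 0, z⟫)| ≤ 1 * (w + w) := by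
        rw [abs_mul]
        gcongr
        · exact abs_coord_le_one b 0 u
        · exact (abs_sub _ _).trans (add_le_add (hxw x hx) (hxw z hz))
      have h3 := (abs_le.1 h2).2
      rw [le_div_iff₀ (by positivity)]
      have h4 : d * R = 4 * ρ := by rw [hρ]; ring
      rw [h4]
      nlinarith)
    (a := 4 * ρ ^ 2) (by
      rw [area_rect, Real.volume_Icc, ← ENNReal.ofReal_mul (by linarith)]
      refine ENNReal.ofReal_le_ofReal (le_of_eq ?_)
      ring)
  have h1 : κ * w * (4 * ρ ^ 2) ≤ 86400 * lam * (4 * w / (d * R)) :=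
    le_trans (by gcongr) hfin
  rw [mul_div_assoc', le_div_iff₀ (by positivity), hρ] at h1
  rw [le_div_iff₀ (by positivity)]
  refine le_of_mul_le_mul_right ?_ hw
  nlinarith

/-- The body is not plate-shaped: if its two largest extents are comparable, then they are
bounded. -/
theorem exists_length_le_of_plate {lam : ℝ} (hlam : 0 < lam) {M : ℝ} (hM : 0 < M) : ∃ C : ℝ,
    ∀ (K : ConvexBody E3) (hK : (interior (K : Set E3)).Nonempty), IsComparable lam K hK →
      (0 : E3) ∈ K → ∀ (b : OrthonormalBasis (Fin 3) ℝ E3) (R r : ℝ), 0 < r → r ≤ R →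
      R ≤ M * r → R • b 2 ∈ K → (∀ x ∈ K, ‖x‖ ≤ R) → ∀ q ∈ K, ⟪b 0, q⟫ = 0 → ⟪b 1, q⟫ = r →
      R ≤ C := by
  -- more dyadic shells than `number_of_shells_le` allows
  obtain ⟨N, hN⟩ := exists_nat_gt (216 * lam * (172800 * lam * M))
  obtain ⟨d, hd⟩ : ∃ d : ℝ, d = (1 / 2) ^ N := ⟨_, rfl⟩
  have hd0 : 0 < d := by rw [hd]; positivity
  have hd1 : d ≤ 1 := by rw [hd]; exact pow_le_one₀ (by norm_num) (by norm_num)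
  refine ⟨1 + (172800 * lam * M / d + 1382400 * lam / (d / (96 * M) * d ^ 3)), ?_⟩
  intro K hK hc h0 b R r hr hrR hRM hp hxR q hq hq0 hq1
  have hR : 0 < R := hr.trans_le hrR
  have h120 : Distinct 1 2 0 := ⟨by decide, by decide, by decide⟩
  have hcube : ∀ {α β : ℝ}, 0 ≤ α → 0 ≤ β → R ^ 3 ≤ α ∨ R ^ 3 ≤ β → R ≤ 1 + (α + β) := by
    intro α β hα hβ hor
    rcases le_total R 1 with h1 | h1
    · linarith
    · have h2 : R ≤ R ^ 3 := le_self_pow₀ h1 (by norm_num)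
      rcases hor with h | h <;> linarith
  refine hcube (by positivity) (by positivity) ?_
  obtain ⟨a, ha, hmax⟩ := K.isCompact.exists_isMaxOn K.nonempty (f := fun x => |⟪b 0, x⟫|)
    (by fun_prop)
  obtain ⟨w, haw⟩ : ∃ w, |⟪b 0, a⟫| = w := ⟨_, rfl⟩
  have hxw : ∀ x ∈ K, |⟪b 0, x⟫| ≤ w := fun x hx => haw ▸ hmax hx
  -- otherwise `K` would lie in a plane
  have hw : 0 < w := by
    obtain ⟨y, hy⟩ := hK
    have hlim : Filter.Tendsto (fun t : ℝ => y + t • b 0) (nhdsWithin 0 (Ioi 0)) (nhds y) := by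
      have : Continuous fun t : ℝ => y + t • b 0 := by fun_prop
      simpa using (this.tendsto 0).mono_left nhdsWithin_le_nhds
    obtain ⟨t, ht, ht0⟩ := ((hlim.eventually (isOpen_interior.mem_nhds hy)).and
      self_mem_nhdsWithin).exists
    have ht0' : 0 < t := ht0
    have h1 := abs_le.1 (hxw y (interior_subset hy))
    have h2 := abs_le.1 (hxw _ (interior_subset ht))
    simp only [inner_add_right, real_inner_smul_right, real_inner_self_eq_norm_sq,
      b.norm_eq_one, one_pow, mul_one] at h2
    rcases lt_or_ge 0 w with h | h
    · exact h
    · linarith [h1.1, h2.2]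
  -- the projection of `K` along `b 2` contains the parallelogram spanned by `q / 2` and `a / 2`
  have hvol : R ^ 2 * w ≤ 172800 * lam * M := by
    have h1 := chord_mul_shadowArea_le hlam hc b (⟨by decide, by decide, by decide⟩ :
      Distinct 0 1 2) hp
    have h2 : r * w / 4 ≤ shadowArea K b 0 1 := by
      have hsub : planeMap ⟪b 0, q⟫ ⟪b 0, a⟫ ⟪b 1, q⟫ ⟪b 1, a⟫ ''
          rect (Icc 0 (1 / 2)) (Icc 0 (1 / 2)) ⊆ shadow b 0 1 '' K := by
        rintro _ ⟨y, ⟨⟨h3, h4⟩, h5, h6⟩, rfl⟩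
        refine ⟨y 0 • q + y 1 • a, comb_mem_of_zero_mem h0 hq ha h3 h5 (by linarith), ?_⟩
        rw [planeMap_apply]
        ext l
        fin_cases l <;> simp [inner_add_right, real_inner_smul_right] <;> ring
      have h3 := measure_mono (μ := (μHE[2] : Measure E2)) hsub
      rw [area_parallelogram, hq0, hq1, zero_mul, zero_sub, abs_neg, abs_mul, haw,
        abs_of_pos hr, ← ofReal_shadowArea] at h3
      rw [mul_comm r w]
      exact (ENNReal.ofReal_le_ofReal_iff (shadowArea_nonneg K b 0 1)).1 h3
    rw [abs_of_pos hR] at h1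
    have h3 : R * (r * w / 4) ≤ 43200 * lam := le_trans (by gcongr) h1
    calc R ^ 2 * w = R * R * w := by ring
      _ ≤ R * (M * r) * w := by gcongr
      _ = 4 * M * (R * (r * w / 4)) := by ring
      _ ≤ 4 * M * (43200 * lam) := by gcongr
      _ = _ := by ring
  rcases lt_or_ge (d * R) w with hdw | hdw
  · left
    rw [le_div_iff₀ hd0]
    nlinarith [sq_nonneg R]
  right
  have hdeep : ∀ v : E3, ‖v‖ = 1 → ⟪b 0, v⟫ = 0 → ∃ x ∈ K, d * R < ⟪v, x⟫ := by
    intro v hv hv0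
    by_contra! hall
    obtain ⟨b', hb0, hb1⟩ := exists_frame (i := 0) (j := 1) (by decide) (by simp) hv hv0
    have h1 := number_of_shells_le hlam hc b' hR hxR hw.le (hb0 ▸ hxw) (hd ▸ hdw)
      (fun x hx => by rw [hb1, ← hd]; exact hall x hx)
    have h2 : 216 * lam * w * R ^ 2 ≤ 216 * lam * (172800 * lam * M) := by
      calc 216 * lam * w * R ^ 2 = 216 * lam * (R ^ 2 * w) := by ring
        _ ≤ _ := by gcongr
    linarith
  have hdisk : ∀ y : E2, ‖y‖ ≤ d * R → ∃ z ∈ K, shadow b 1 2 z = y := fun y hy =>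
    exists_shadow_eq b hdeep hy
  obtain ⟨g, hg, hgw⟩ := exists_chord h0 b hr hrR hd0 hd1 hp hxR hq hq0 hq1 ha haw hdisk
  refine length_le_of_disk hlam hc b hR hd0 hw (by positivity) hxw hdisk hg (le_trans ?_ hgw)
  rw [le_div_iff₀ (by positivity), div_mul_eq_mul_div, div_mul_eq_mul_div,
    div_le_iff₀ (by positivity)]
  have : d * w * (96 * R) ≤ d * w * (96 * (M * r)) := by gcongr
  linarith

end LogMinkowski

theorem lemma1 (lam : ℝ) (hlam : 0 < lam) :
    ∃ C : ℝ, ∀ (f : LogMinkowski.S2 → ℝ) (K : ConvexBody LogMinkowski.E3)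
      (hK : (interior (K : Set LogMinkowski.E3)).Nonempty),
      (0 : LogMinkowski.E3) ∈ closure (K : Set LogMinkowski.E3) →
      AEMeasurable f LogMinkowski.sphereArea →
      (∀ u, 1 / lam < f u ∧ f u < lam) →
      LogMinkowski.supportSurfaceMeasure K hK =
        LogMinkowski.sphereArea.withDensity (fun u => ENNReal.ofReal (f u)) →
      ∀ u : LogMinkowski.S2, |LogMinkowski.supportFunction K u| ≤ C := by
  open LogMinkowski in
  obtain ⟨M, hM, hneedle⟩ := exists_length_le_width hlam
  obtain ⟨C, hplate⟩ := exists_length_le_of_plate hlam hM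
  refine ⟨max C 0, fun f K hK h0 _ hf hmeas u => ?_⟩
  have h0 : (0 : E3) ∈ K := by
    rwa [K.isClosed.closure_eq] at h0
  have hc : IsComparable lam K hK := isComparable_of_density hf hmeas
  obtain ⟨p, hp, hmax⟩ := K.isCompact.exists_isMaxOn K.nonempty (f := fun x => ‖x‖) (by fun_prop)
  have hxR : ∀ x ∈ K, ‖x‖ ≤ ‖p‖ := fun x hx => hmax hx
  have hsupp : |supportFunction K u| ≤ ‖p‖ := by
    have h1 := inner_le_supportFunction K u h0
    rw [inner_zero_right] at h1
    rw [abs_of_nonneg h1]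
    refine supportFunction_le K u fun x hx => ?_
    have := real_inner_le_norm (u : E3) x
    rw [norm_coe_S2, one_mul] at this
    exact this.trans (hxR x hx)
  refine hsupp.trans ?_
  rcases (norm_nonneg p).eq_or_lt with hR | hR
  · rw [← hR]
    exact le_max_right _ _
  refine le_trans ?_ (le_max_left _ _)
  have h012 : Distinct 0 1 2 := ⟨by decide, by decide, by decide⟩
  obtain ⟨b, hb⟩ : ∃ b : OrthonormalBasis (Fin 3) ℝ E3, b 2 = ‖p‖⁻¹ • p := by
    have hn : ‖‖p‖⁻¹ • p‖ = 1 := by simp [norm_smul, hR.ne']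
    have ho : Orthonormal ℝ (({2} : Set (Fin 3)).domRestrict fun _ => ‖p‖⁻¹ • p) := by
      refine ⟨fun _ => hn, fun i j hij => absurd (Subsingleton.elim i j) hij⟩
    obtain ⟨b, hb⟩ := ho.exists_orthonormalBasis_extension_of_card_eq (by simp)
    exact ⟨b, hb 2 rfl⟩
  have hbp : ‖p‖ • b 2 ∈ K := by
    rw [hb, smul_smul, mul_inv_cancel₀ hR.ne', one_smul]
    exact hp
  obtain ⟨q, hq, hqmax⟩ := K.isCompact.exists_isMaxOn K.nonempty
    (f := fun x => ‖shadow b 0 1 x‖) (continuous_shadow b 0 1).norm.continuousOn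
  have hlen := hneedle K hK hc h0 b ‖p‖ _ hR hbp hxR (fun x hx => hqmax hx) q hq rfl
  have hr : 0 < ‖shadow b 0 1 q‖ := by
    by_contra! hle
    have := mul_nonpos_of_nonneg_of_nonpos hM.le hle
    linarith
  have hrR : ‖shadow b 0 1 q‖ ≤ ‖p‖ := by
    refine le_trans (le_of_sq_le_sq ?_ (norm_nonneg _)) (hxR q hq)
    rw [norm_shadow_sq b h012]
    nlinarith [sq_nonneg ⟪b 2, q⟫]
  set r := ‖shadow b 0 1 q‖ with hrdef
  -- the unit vector orthogonal to the axis that points from the axis towards `q`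
  set e : E3 := r⁻¹ • (q - ⟪b 2, q⟫ • b 2) with he
  have hb22 : ⟪b 2, b 2⟫ = 1 := by rw [real_inner_self_eq_norm_sq, b.norm_eq_one, one_pow]
  have he2 : ⟪e, b 2⟫ = 0 := by
    rw [he, real_inner_smul_left, inner_sub_left, real_inner_smul_left, hb22,
      real_inner_comm]
    ring
  have hqe : q = r • e + ⟪b 2, q⟫ • b 2 := by
    rw [he, smul_smul, mul_inv_cancel₀ hr.ne', one_smul]
    abel
  have hen : ‖e‖ = 1 := by
    have h1 : ‖q - ⟪b 2, q⟫ • b 2‖ ^ 2 = r ^ 2 := by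
      rw [hrdef, norm_shadow_sq b h012, norm_sub_sq_real, norm_smul, real_inner_smul_right,
        b.norm_eq_one, mul_one, Real.norm_eq_abs, sq_abs, real_inner_comm]
      ring
    rw [sq_eq_sq₀ (norm_nonneg _) hr.le] at h1
    rw [he, norm_smul, h1, norm_inv, Real.norm_eq_abs, abs_of_pos hr, inv_mul_cancel₀ hr.ne']
  clear_value e
  obtain ⟨b', hb1, hb2⟩ := exists_frame (i := 1) (j := 2) (by decide) hen (b.norm_eq_one 2) he2
  refine hplate K hK hc h0 b' ‖p‖ r hr hrR hlen (hb2 ▸ hbp) hxR q hq ?_ ?_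
  · rw [hqe, ← hb1, ← hb2, inner_add_right, real_inner_smul_right, real_inner_smul_right,
      b'.inner_eq_zero (by decide), b'.inner_eq_zero (by decide)]
    ring
  · rw [hqe, hb1, inner_add_right, real_inner_smul_right, real_inner_smul_right, he2,
      real_inner_self_eq_norm_sq, hen]
    ring
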